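/- Let $\mathcal F$ be the class of convex functions $f:[0,\infty)\to\mathbb R$ with $f(1)=0$ and $f(0)=f(0^+)$ that are twice differentiable on $(0,\infty)$ with $f''>0$ and $1/f''$ concave there. For probability measures $P,Q$ put $D_f(P\|Q)=\mathbb E_Q\big[f\big(\tfrac{dP}{dQ}\big)\big]\in[0,\infty]$ if $P\ll Q$, and $D_f(P\|Q)=\infty$ otherwise. For random variables $A,B$ define $$I_f^{CKZ}(A;B)=D_f(P_{AB}\|P_A\times P_B),$$ $$I_f^{MBGYA}(A;B)=\inf_{Q_B}\big\{D_f(P_{AB}\|P_A\times Q_B)-D_f(P_B\|Q_B)\big\},$$ where the infimum is over all probability measures $Q_B$ with $P_B\ll Q_B$ and $D_f(P_B\|Q_B)<\infty$ (so that the difference is meaningful). Let $\mathcal X,\hat{\mathcal X}$ be measurable spaces, $P_X$ a probability measure on $\mathcal X$, $d:\mathcal X\times\hat{\mathcal X}\to\mathbb R$ a measurable distortion function (possibly negative), and $X\sim P_X$. For $\star\in\{CKZ,MBGYA\}$ and $R\in\mathbb R$ let $$\mathscr D_f^{\star}(R)=\inf_{P_{\hat X|X}:\ I_f^{\star}(X;\hat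 X)\le R}\mathbb E[d(X,\hat X)].$$ Theorem. Let $f\in\mathcal F$, let $n\ge 1$ be an integer, and let $X^n=(X_1,\dots,X_n)$ be i.i.d. according to $P_X$. Then for every $R\in\mathbb R$ $$\inf_{P_{\hat X^n|X^n}:\ I_f^{CKZ}(X^n;\hat X^n)\le nR}\ \frac1n\sum_{i=1}^n\mathbb E[d(X_i,\hat X_i)]\ \ge\ \mathscr D_f^{CKZ}(R)$$ and $$\inf_{P_{\hat X^n|X^n}:\ I_f^{MBGYA}(X^n;\hat X^n)\le nR}\ \frac1n\sum_{i=1}^n\mathbb E[d(X_i,\hat X_i)]\ \ge\ \mathscr D_f^{MBGYA}(R).$$ Here the infima run over Markov kernels from $\mathcal X$ to $\hat{\mathcal X}$ (respectively from $\mathcal X^n$ to $\hat{\mathcal X}^n$) for which the expectation (respectively the sum of expectations) is well defined in $[-\infty,\infty]$, i.e. no $\infty-\infty$ occurs within an expectation or between two of them; the infimum of the empty set is $+\infty$. -/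

import Mathlib

open MeasureTheory ProbabilityTheory
open scoped ENNReal

namespace FInfo

/-- The class `𝓕`: convex functions `f` on `[0, ∞)` with `f 1 = 0`, `f 0 = f (0⁺)`, twice
differentiable on `(0, ∞)` with `f'' > 0` there and `1 / f''` concave. (The values of `f` on negative
reals are irrelevant.) -/
structure ClassF (f : ℝ → ℝ) : Prop where
  convexOn : ConvexOn ℝ (Set.Ici 0) f
  map_one : f 1 = 0
  continuousWithinAt_zero : ContinuousWithinAt f (Set.Ici 0) 0
  differentiableAt : ∀ t : ℝ, 0 < t → DifferentiableAt ℝ f t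
  differentiableAt_deriv : ∀ t : ℝ, 0 < t → DifferentiableAt ℝ (deriv f) t
  deriv_deriv_pos : ∀ t : ℝ, 0 < t → 0 < deriv (deriv f) t
  concaveOn_inv : ConcaveOn ℝ (Set.Ioi 0) (fun t => 1 / deriv (deriv f) t)

open Classical in
/-- The `f`-divergence `D_f(P ‖ Q) = E_Q [f (dP/dQ)]`, with values in `(-∞, ∞]`. A convex `f` is bounded
below by an affine function, so if `f (dP/dQ)` is not `Q`-integrable, its `Q`-expectation is `+∞`. If `P`
is not absolutely continuous with respect to `Q`, the value is `+∞` (the usual convention when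
`f t / t → ∞` as `t → ∞`, which holds for every `f` in the class `𝓕`). -/
noncomputable def fDiv {α : Type*} [MeasurableSpace α] (f : ℝ → ℝ) (P Q : Measure α) : EReal :=
  if P ≪ Q ∧ Integrable (fun a => f (P.rnDeriv Q a).toReal) Q then
    ((∫ a, f (P.rnDeriv Q a).toReal ∂Q : ℝ) : EReal)
  else ⊤

/-- `I_f^{CKZ}(A; B) = D_f(P_{AB} ‖ P_A × P_B)`, for `(A, B)` of joint law `μ`. -/
noncomputable def infoCKZ {α β : Type*} [MeasurableSpace α] [MeasurableSpace β]
    (f : ℝ → ℝ) (μ : Measure (α × β)) : EReal :=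
  fDiv f μ (μ.fst.prod μ.snd)

/-- `I_f^{MBGYA}(A; B) = inf_{Q_B} { D_f(P_{AB} ‖ P_A × Q_B) - D_f(P_B ‖ Q_B) }`, for `(A, B)` of joint
law `μ`. The infimum is over the probability measures `Q_B` with `P_B ≪ Q_B` and
`D_f(P_B ‖ Q_B) < ∞`; the last condition only excludes the meaningless difference `∞ - ∞`. -/
noncomputable def infoMBGYA {α β : Type*} [MeasurableSpace α] [MeasurableSpace β]
    (f : ℝ → ℝ) (μ : Measure (α × β)) : EReal :=
  ⨅ (Q : Measure β) (_ : IsProbabilityMeasure Q) (_ : μ.snd ≪ Q) (_ : fDiv f μ.snd Q ≠ ⊤),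
    (fDiv f μ (μ.fst.prod Q) - fDiv f μ.snd Q)

/-- `E[d(X, X̂)⁺]` for `(X, X̂)` of joint law `μ`. -/
noncomputable def posDistortion {α β : Type*} [MeasurableSpace α] [MeasurableSpace β]
    (d : α → β → ℝ) (μ : Measure (α × β)) : ℝ≥0∞ :=
  ∫⁻ z, ENNReal.ofReal (d z.1 z.2) ∂μ

/-- `E[d(X, X̂)⁻]` for `(X, X̂)` of joint law `μ`. -/
noncomputable def negDistortion {α β : Type*} [MeasurableSpace α] [MeasurableSpace β]
    (d : α → β → ℝ) (μ : Measure (α × β)) : ℝ≥0∞ :=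
  ∫⁻ z, ENNReal.ofReal (-(d z.1 z.2)) ∂μ

/-- The expected distortion `E[d(X, X̂)] = E[d(X, X̂)⁺] - E[d(X, X̂)⁻]` in `[-∞, ∞]`, for `(X, X̂)` of
joint law `μ`. It is only used where the two terms are not both infinite. -/
noncomputable def expDistortion {α β : Type*} [MeasurableSpace α] [MeasurableSpace β]
    (d : α → β → ℝ) (μ : Measure (α × β)) : EReal :=
  (posDistortion d μ : EReal) - (negDistortion d μ : EReal)

/-- The single-letter distortion-rate function
`inf { E[d(X, X̂)] : P_{X̂|X} with I(X; X̂) ≤ R }` of the source `X ∼ P`, for a measure of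
correlation `I` (a functional of the joint law). The infimum is over the channels for which the expected
distortion is well defined in `[-∞, ∞]`; it is `+∞` if there is none. -/
noncomputable def distortionRate {α β : Type*} [MeasurableSpace α] [MeasurableSpace β]
    (I : Measure (α × β) → EReal) (P : Measure α) (d : α → β → ℝ) (R : ℝ) : EReal :=
  ⨅ (κ : Kernel α β) (_ : IsMarkovKernel κ) (_ : I (P.compProd κ) ≤ (R : EReal))
    (_ : posDistortion d (P.compProd κ) ≠ ⊤ ∨ negDistortion d (P.compProd κ) ≠ ⊤),
    expDistortion d (P.compProd κ)

/-- The joint law of `(X^n, X̂^n)` for `X^n` i.i.d. of law `P` and `P_{X̂^n|X^n} = κ`. -/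
noncomputable def blockLaw {α β : Type*} [MeasurableSpace α] [MeasurableSpace β] {n : ℕ}
    (P : Measure α) (κ : Kernel (Fin n → α) (Fin n → β)) :
    Measure ((Fin n → α) × (Fin n → β)) :=
  (Measure.pi fun _ : Fin n => P).compProd κ

/-- The law of the pair `(X_i, X̂_i)` for `(X^n, X̂^n)` of joint law `μ`. -/
noncomputable def letterLaw {α β : Type*} [MeasurableSpace α] [MeasurableSpace β] {n : ℕ}
    (μ : Measure ((Fin n → α) × (Fin n → β))) (i : Fin n) : Measure (α × β) :=
  μ.map fun z => (z.1 i, z.2 i)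

/-- The `n`-letter distortion-rate problem
`inf { (1/n) ∑ᵢ E[d(X_i, X̂_i)] : P_{X̂^n|X^n} with I(X^n; X̂^n) ≤ n R }` for `X^n` i.i.d. of law `P`.
The infimum is over the channels for which the sum of expectations is well defined in `[-∞, ∞]`
(no `∞ - ∞` within an expectation or between two of them). -/
noncomputable def blockDistortionRate {α β : Type*} [MeasurableSpace α] [MeasurableSpace β] (n : ℕ)
    (I : Measure ((Fin n → α) × (Fin n → β)) → EReal)
    (P : Measure α) (d : α → β → ℝ) (R : ℝ) : EReal :=
  ⨅ (κ : Kernel (Fin n → α) (Fin n → β)) (_ : IsMarkovKernel κ)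
    (_ : I (blockLaw P κ) ≤ (((n : ℝ) * R : ℝ) : EReal))
    (_ : (∀ i, posDistortion d (letterLaw (blockLaw P κ) i) ≠ ⊤) ∨
      (∀ i, negDistortion d (letterLaw (blockLaw P κ) i) ≠ ⊤)),
    ((1 / (n : ℝ) : ℝ) : EReal) * ∑ i, expDistortion d (letterLaw (blockLaw P κ) i)

end FInfo

namespace FInfo

open Filter Set Topology

/-! Write B(u, v) for `bregman f u v`. For fixed Q_B, the difference D_f(P_AB ‖ P_A × Q_B) - D_f(P_B
‖ Q_B), when finite, is the mean under P_A × Q_B of B(dP_AB/d(P_A × Q_B), dP_B/dQ_B), because the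
second density is the conditional expectation of the first given the second coordinate. Concavity of
1/f'' makes B jointly convex: Taylor's remainder writes B as an integral of terms f''(w) z², each
jointly convex in (w, z). By a conditional Jensen argument, the mean of B can only decrease when
both arguments are replaced by conditional expectations (`ClassF.integral_bregman_condExp_le`).

For a block law μ, put ν = P^n × Q and let r_k be the ν-conditional expectation of dμ/dν given the
first k source letters and the whole reproduction. The means of B(r_{k+1}, r_k) telescope to the
block difference. With letters counted from 0, projection to the k-th letter pair sends r_{k+1}ν to
the law of (X_k, X̂_k). It sends r_kν to P times the law of X̂_k, since X_k is ν-independent of the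
prefix and the reproduction. Adjoining a uniform index k and applying data processing once bounds
the value at the averaged letter law by 1/n times the block value (`ClassF.letter_le_block`).

The averaged law comes from a single-letter channel, and expected distortion is linear in the law.
For CKZ one takes Q to be the reproduction marginal; for MBGYA each block Q yields the average of
its coordinate marginals as a single-letter competitor. -/

/-- The Bregman divergence of `f`. -/
noncomputable def bregman (f : ℝ → ℝ) (u v : ℝ) : ℝ := f u - f v - deriv f v * (u - v)

/-! ### Joint convexity of the Bregman divergence -/

section Analysis

variable {f : ℝ → ℝ}

lemma ClassF.bregman_nonneg (hf : ClassF f) {u v : ℝ} (hu : 0 ≤ u) (hv : 0 < v) :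
    0 ≤ bregman f u v := by
  have hd := (hf.differentiableAt v hv).hasDerivAt
  unfold bregman
  rcases lt_trichotomy u v with h | h | h
  · have := hf.convexOn.slope_le_of_hasDerivAt (mem_Ici.2 hu) (mem_Ici.2 hv.le) h hd
    rw [slope_def_field, div_le_iff₀ (by linarith)] at this
    linarith
  · simp [h]
  · have := hf.convexOn.le_slope_of_hasDerivAt (mem_Ici.2 hv.le) (mem_Ici.2 hu) h hd
    rw [slope_def_field, le_div_iff₀ (by linarith)] at this
    linarith

lemma ClassF.continuousOn (hf : ClassF f) : ContinuousOn f (Ici 0) :=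
  hf.convexOn.continuousOn_Ici hf.continuousWithinAt_zero

/-- Continuity of f'' is not assumed: it comes from the concavity of 1/f'' on an open interval. -/
lemma ClassF.continuousOn_deriv_deriv (hf : ClassF f) :
    ContinuousOn (deriv (deriv f)) (Ioi 0) := by
  have h : ContinuousOn (fun t => (1 / deriv (deriv f) t)⁻¹) (Ioi 0) :=
    (hf.concaveOn_inv.continuousOn isOpen_Ioi).inv₀ fun t ht =>
      (one_div_pos.2 (hf.deriv_deriv_pos t ht)).ne'
  exact h.congr fun t _ => by simp

/-- The function `(w, z) ↦ f'' w * z ^ 2` is jointly convex. -/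
lemma ClassF.deriv_deriv_mul_sq_convex (hf : ClassF f) {w₀ w₁ z₀ z₁ p q : ℝ}
    (h₀ : 0 < w₀) (h₁ : 0 < w₁) (hp : 0 ≤ p) (hq : 0 ≤ q) (hpq : p + q = 1) :
    deriv (deriv f) (p * w₀ + q * w₁) * (p * z₀ + q * z₁) ^ 2 ≤
      p * (deriv (deriv f) w₀ * z₀ ^ 2) + q * (deriv (deriv f) w₁ * z₁ ^ 2) := by
  have hw : 0 < p * w₀ + q * w₁ :=
    (convex_Ioi (0 : ℝ)) (mem_Ioi.2 h₀) (mem_Ioi.2 h₁) hp hq hpq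
  have hc := hf.concaveOn_inv.2 (mem_Ioi.2 h₀) (mem_Ioi.2 h₁) hp hq hpq
  simp only [smul_eq_mul] at hc
  set A := deriv (deriv f) w₀
  set B := deriv (deriv f) w₁
  set C := deriv (deriv f) (p * w₀ + q * w₁)
  have hA : 0 < A := hf.deriv_deriv_pos _ h₀
  have hB : 0 < B := hf.deriv_deriv_pos _ h₁
  have hC : 0 < C := hf.deriv_deriv_pos _ hw
  -- Cauchy–Schwarz with weights A, B, with its defect written out explicitly.
  have key : (p * z₀ + q * z₁) ^ 2 ≤
      (p * (A * z₀ ^ 2) + q * (B * z₁ ^ 2)) * (p * (1 / A) + q * (1 / B)) := by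
    have : (p * (A * z₀ ^ 2) + q * (B * z₁ ^ 2)) * (p * (1 / A) + q * (1 / B)) -
        (p * z₀ + q * z₁) ^ 2 = p * q * (A * z₀ - B * z₁) ^ 2 / (A * B) := by
      field_simp
      ring
    have : 0 ≤ p * q * (A * z₀ - B * z₁) ^ 2 / (A * B) := by positivity
    linarith
  have h2 : (p * z₀ + q * z₁) ^ 2 ≤ (p * (A * z₀ ^ 2) + q * (B * z₁ ^ 2)) * (1 / C) :=
    key.trans (mul_le_mul_of_nonneg_left hc (by positivity))
  rw [mul_one_div, le_div_iff₀ hC] at h2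
  linarith

lemma segment_pos {u v s : ℝ} (hu : 0 < u) (hv : 0 < v) (h0 : 0 ≤ s) (h1 : s ≤ 1) :
    0 < v + s * (u - v) := by
  rcases eq_or_lt_of_le h0 with rfl | h
  · simpa using hv
  · nlinarith [mul_pos h hu, mul_nonneg (sub_nonneg.2 h1) hv.le]

lemma ClassF.continuousOn_remainder (hf : ClassF f) {u v : ℝ} (hu : 0 < u) (hv : 0 < v) :
    ContinuousOn (fun s => (1 - s) * (deriv (deriv f) (v + s * (u - v)) * (u - v) ^ 2))
      (Icc 0 1) := by
  refine ContinuousOn.mul (by fun_prop) (ContinuousOn.mul ?_ continuousOn_const)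
  exact hf.continuousOn_deriv_deriv.comp (by fun_prop) fun s hs => segment_pos hu hv hs.1 hs.2

/-- Taylor's formula with integral remainder. -/
lemma ClassF.bregman_eq_integral (hf : ClassF f) {u v : ℝ} (hu : 0 < u) (hv : 0 < v) :
    bregman f u v =
      ∫ s in (0 : ℝ)..1, (1 - s) * (deriv (deriv f) (v + s * (u - v)) * (u - v) ^ 2) := by
  have hd : ∀ s ∈ uIcc (0 : ℝ) 1, HasDerivAt
      (fun s => f (v + s * (u - v)) + (1 - s) * (deriv f (v + s * (u - v)) * (u - v)))
      ((1 - s) * (deriv (deriv f) (v + s * (u - v)) * (u - v) ^ 2)) s := by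
    intro s hs
    rw [uIcc_of_le zero_le_one] at hs
    have hp := segment_pos hu hv hs.1 hs.2
    have hl : HasDerivAt (fun s => v + s * (u - v)) (u - v) s := by
      simpa using ((hasDerivAt_id s).mul_const (u - v)).const_add v
    have h1 := (hf.differentiableAt _ hp).hasDerivAt.comp s hl
    have h2 := (hf.differentiableAt_deriv _ hp).hasDerivAt.comp s hl
    have h3 := ((hasDerivAt_id s).const_sub 1).mul (h2.mul_const (u - v))
    refine (h1.add h3).congr_deriv ?_
    simp only [Function.comp_apply, id]
    ring
  rw [intervalIntegral.integral_eq_sub_of_hasDerivAt hd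
    (ContinuousOn.intervalIntegrable_of_Icc zero_le_one (hf.continuousOn_remainder hu hv))]
  simp [bregman]
  ring

/-- For each s the Taylor integrand is (1 - s) f''(w) z² with w and z linear in (u, v), so convexity
holds under the integral. -/
lemma ClassF.bregman_convex (hf : ClassF f) {u₀ v₀ u₁ v₁ p q : ℝ} (hu₀ : 0 < u₀) (hv₀ : 0 < v₀)
    (hu₁ : 0 < u₁) (hv₁ : 0 < v₁) (hp : 0 ≤ p) (hq : 0 ≤ q) (hpq : p + q = 1) :
    bregman f (p * u₀ + q * u₁) (p * v₀ + q * v₁) ≤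
      p * bregman f u₀ v₀ + q * bregman f u₁ v₁ := by
  have hu : 0 < p * u₀ + q * u₁ :=
    (convex_Ioi (0 : ℝ)) (mem_Ioi.2 hu₀) (mem_Ioi.2 hu₁) hp hq hpq
  have hv : 0 < p * v₀ + q * v₁ :=
    (convex_Ioi (0 : ℝ)) (mem_Ioi.2 hv₀) (mem_Ioi.2 hv₁) hp hq hpq
  have hI : ∀ {u v : ℝ}, 0 < u → 0 < v → IntervalIntegrable
      (fun s => (1 - s) * (deriv (deriv f) (v + s * (u - v)) * (u - v) ^ 2)) volume 0 1 :=
    fun hu hv => ContinuousOn.intervalIntegrable_of_Icc zero_le_one (hf.continuousOn_remainder hu hv)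
  rw [hf.bregman_eq_integral hu hv, hf.bregman_eq_integral hu₀ hv₀, hf.bregman_eq_integral hu₁ hv₁,
    ← intervalIntegral.integral_const_mul, ← intervalIntegral.integral_const_mul,
    ← intervalIntegral.integral_add ((hI hu₀ hv₀).const_mul p) ((hI hu₁ hv₁).const_mul q)]
  refine intervalIntegral.integral_mono_on zero_le_one (hI hu hv)
    (((hI hu₀ hv₀).const_mul p).add ((hI hu₁ hv₁).const_mul q)) fun s hs => ?_
  have := hf.deriv_deriv_mul_sq_convex (z₀ := u₀ - v₀) (z₁ := u₁ - v₁)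
    (segment_pos hu₀ hv₀ hs.1 hs.2) (segment_pos hu₁ hv₁ hs.1 hs.2) hp hq hpq
  have h2 := mul_le_mul_of_nonneg_left this (sub_nonneg.2 hs.2)
  rw [show p * v₀ + q * v₁ + s * (p * u₀ + q * u₁ - (p * v₀ + q * v₁)) =
    p * (v₀ + s * (u₀ - v₀)) + q * (v₁ + s * (u₁ - v₁)) by ring,
    show p * u₀ + q * u₁ - (p * v₀ + q * v₁) = p * (u₀ - v₀) + q * (u₁ - v₁) by ring]
  linarith

/-- The tangent plane of `bregman f` at `(a, b)`, evaluated at `(u, v)`. -/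
noncomputable def bregmanTangent (f : ℝ → ℝ) (a b u v : ℝ) : ℝ :=
  bregman f a b + (deriv f a - deriv f b) * (u - a) - deriv (deriv f) b * (a - b) * (v - b)

/-- Along the segment from (a, b) to (u, v) the divergence is a convex function of one variable,
hence lies above its tangent at 0. -/
lemma ClassF.bregmanTangent_le_of_pos (hf : ClassF f) {a b u v : ℝ} (ha : 0 < a) (hb : 0 < b)
    (hu : 0 < u) (hv : 0 < v) : bregmanTangent f a b u v ≤ bregman f u v := by
  have hc : ConvexOn ℝ (Icc 0 1)
      (fun t => bregman f (a + t * (u - a)) (b + t * (v - b))) := by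
    refine ⟨convex_Icc 0 1, fun s hs t ht p q hp hq hpq => ?_⟩
    have := hf.bregman_convex (segment_pos hu ha hs.1 hs.2) (segment_pos hv hb hs.1 hs.2)
      (segment_pos hu ha ht.1 ht.2) (segment_pos hv hb ht.1 ht.2) hp hq hpq
    simp only [smul_eq_mul]
    rwa [show a + (p * s + q * t) * (u - a) = p * (a + s * (u - a)) + q * (a + t * (u - a)) by
        linear_combination -a * hpq,
      show b + (p * s + q * t) * (v - b) = p * (b + s * (v - b)) + q * (b + t * (v - b)) by
        linear_combination -b * hpq]
  have hla : HasDerivAt (fun t => a + t * (u - a)) (u - a) 0 := by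
    simpa using ((hasDerivAt_id (0 : ℝ)).mul_const (u - a)).const_add a
  have hlb : HasDerivAt (fun t => b + t * (v - b)) (v - b) 0 := by
    simpa using ((hasDerivAt_id (0 : ℝ)).mul_const (v - b)).const_add b
  have h1 : HasDerivAt (fun t => f (a + t * (u - a))) (deriv f a * (u - a)) 0 :=
    HasDerivAt.comp (0 : ℝ) (by simpa using (hf.differentiableAt a ha).hasDerivAt) hla
  have h2 : HasDerivAt (fun t => f (b + t * (v - b))) (deriv f b * (v - b)) 0 :=
    HasDerivAt.comp (0 : ℝ) (by simpa using (hf.differentiableAt b hb).hasDerivAt) hlb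
  have h3 : HasDerivAt (fun t => deriv f (b + t * (v - b))) (deriv (deriv f) b * (v - b)) 0 :=
    HasDerivAt.comp (h₂ := deriv f) (0 : ℝ)
      (by simpa using (hf.differentiableAt_deriv b hb).hasDerivAt) hlb
  have hd := ((h1.sub h2).sub (h3.mul (hla.sub hlb)))
  have := hc.le_slope_of_hasDerivAt (x := 0) (y := 1) (by simp) (by simp) one_pos hd
  simp only [slope_def_field, sub_zero, div_one, one_mul, zero_mul, add_zero, Pi.sub_apply,
    add_sub_cancel] at this
  unfold bregmanTangent
  linarith

/-- Densities may vanish, and `deriv f 0` is then meaningless. The four implications hold almost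
everywhere for densities and their conditional expectations, and make every such term carry a zero
factor; the remaining cases are limits from positive arguments. -/
lemma ClassF.bregmanTangent_le (hf : ClassF f) {a b u v : ℝ} (ha : 0 ≤ a) (hb : 0 ≤ b)
    (hu : 0 ≤ u) (hv : 0 ≤ v) (hvu : v = 0 → u = 0) (hau : a = 0 → u = 0) (hbv : b = 0 → v = 0)
    (hba : b = 0 → a = 0) : bregmanTangent f a b u v ≤ bregman f u v := by
  rcases hb.eq_or_lt with rfl | hb
  · obtain rfl := hbv rfl
    obtain rfl := hvu rfl
    obtain rfl := hba rfl
    simp [bregmanTangent]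
  have hf0 : Tendsto f (𝓝[>] 0) (𝓝 (f 0)) :=
    hf.continuousWithinAt_zero.mono_left (nhdsWithin_mono _ Ioi_subset_Ici_self)
  have hid : Tendsto (fun s : ℝ => s) (𝓝[>] 0) (𝓝 0) := tendsto_nhdsWithin_of_tendsto_nhds tendsto_id
  have hpos : ∀ᶠ s : ℝ in 𝓝[>] 0, 0 < s := eventually_mem_nhdsWithin
  -- positive `a`, the other cases by letting `a` and `u` tend to `0` together
  have main : ∀ a u : ℝ, 0 < a → 0 ≤ u → (v = 0 → u = 0) →
      bregmanTangent f a b u v ≤ bregman f u v := by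
    intro a u ha hu hvu
    rcases hv.eq_or_lt with rfl | hv
    · obtain rfl := hvu rfl
      have hlim : Tendsto (fun s => bregmanTangent f a b s s) (𝓝[>] 0)
          (𝓝 (bregmanTangent f a b 0 0)) := by
        unfold bregmanTangent
        exact ((hid.sub_const a).const_mul _ |>.const_add _).sub ((hid.sub_const b).const_mul _)
      refine le_of_tendsto_of_tendsto hlim (tendsto_const_nhds (x := bregman f 0 0)) ?_
      filter_upwards [hpos] with s hs
      simpa [bregman] using hf.bregmanTangent_le_of_pos ha hb hs hs
    rcases hu.eq_or_lt with rfl | hu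
    · have hlim : Tendsto (fun s => bregmanTangent f a b s v) (𝓝[>] 0)
          (𝓝 (bregmanTangent f a b 0 v)) := by
        unfold bregmanTangent
        exact ((hid.sub_const a).const_mul _ |>.const_add _).sub_const _
      have hlim2 : Tendsto (fun s => bregman f s v) (𝓝[>] 0) (𝓝 (bregman f 0 v)) := by
        unfold bregman
        exact (hf0.sub_const _).sub ((hid.sub_const v).const_mul _)
      refine le_of_tendsto_of_tendsto hlim hlim2 ?_
      filter_upwards [hpos] with s hs using hf.bregmanTangent_le_of_pos ha hb hs hv
    · exact hf.bregmanTangent_le_of_pos ha hb hu hv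
  rcases ha.eq_or_lt with rfl | ha
  · obtain rfl := hau rfl
    rcases hv.eq_or_lt with rfl | hv
    · have hlim : Tendsto (fun s => bregman f s b - deriv (deriv f) b * (s - b) * (s - b))
          (𝓝[>] 0) (𝓝 (bregman f 0 b - deriv (deriv f) b * (0 - b) * (0 - b))) := by
        unfold bregman
        exact ((hf0.sub_const _).sub ((hid.sub_const b).const_mul _)).sub
          (((hid.sub_const b).const_mul _).mul (hid.sub_const b))
      have h0 : bregman f 0 b - deriv (deriv f) b * (0 - b) * (0 - b) ≤ 0 := by
        refine le_of_tendsto hlim ?_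
        filter_upwards [hpos] with s hs
        simpa [bregmanTangent, bregman] using hf.bregmanTangent_le_of_pos hs hb hs hs
      simpa [bregmanTangent, bregman] using h0
    · have hlim : Tendsto (fun s => bregman f s b - deriv (deriv f) b * (s - b) * (v - b))
          (𝓝[>] 0) (𝓝 (bregmanTangent f 0 b 0 v)) := by
        have : bregmanTangent f 0 b 0 v =
          bregman f 0 b - deriv (deriv f) b * (0 - b) * (v - b) := by
            simp [bregmanTangent]
        rw [this]
        unfold bregman
        exact ((hf0.sub_const _).sub ((hid.sub_const b).const_mul _)).sub
          (((hid.sub_const b).const_mul _).mul_const _)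
      have hlim2 : Tendsto (fun s => bregman f s v) (𝓝[>] 0) (𝓝 (bregman f 0 v)) := by
        unfold bregman
        exact (hf0.sub_const _).sub ((hid.sub_const v).const_mul _)
      refine le_of_tendsto_of_tendsto hlim hlim2 ?_
      filter_upwards [hpos] with s hs
      simpa [bregmanTangent] using main s s hs hs.le (fun h => absurd h hv.ne')
  · exact main a u ha hu hvu

end Analysis

/-! ### Conditional Jensen for the Bregman divergence -/

section CondExp

variable {Ω : Type*} {m m0 : MeasurableSpace Ω} {ν : Measure Ω} {f : ℝ → ℝ} {u v a b : Ω → ℝ}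

lemma aecover_abs_le {g : Ω → ℝ} (hg : Measurable g) :
    AECover ν atTop fun N : ℕ => {x | |g x| ≤ N} where
  ae_eventually_mem := ae_of_all _ fun x => by
    obtain ⟨N, hN⟩ := exists_nat_ge |g x|
    filter_upwards [eventually_ge_atTop N] with M hM
    exact hN.trans (Nat.cast_le.2 hM)
  measurableSet N := measurableSet_le hg.abs measurable_const

lemma integrableOn_mul_sub_condExp [IsFiniteMeasure ν] (hm : m ≤ m0) (hu : Integrable u ν)
    (ha : a =ᵐ[ν] ν[u|m]) {h : Ω → ℝ} (hh : Measurable[m] h) {S : Set Ω}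
    (hS : MeasurableSet[m] S) {c : ℝ} (hc : ∀ x ∈ S, |h x| ≤ c) :
    IntegrableOn (fun x => h x * (u x - a x)) S ν := by
  have hua : Integrable (fun x => u x - a x) ν := hu.sub (integrable_condExp.congr ha.symm)
  refine Integrable.bdd_mul (c := c) hua.integrableOn
    (hh.mono hm le_rfl).aestronglyMeasurable.restrict ?_
  filter_upwards [ae_restrict_mem (hm _ hS)] with x hx using hc x hx

/-- Orthogonality of u - E[u|m] to m-measurable factors. It is localized to a set where the factor
is bounded because f'(a) (u - a) is not known to be integrable. -/
lemma setIntegral_mul_sub_condExp [IsFiniteMeasure ν] (hm : m ≤ m0) (hu : Integrable u ν)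
    (ha : a =ᵐ[ν] ν[u|m]) {h : Ω → ℝ} (hh : Measurable[m] h) {S : Set Ω}
    (hS : MeasurableSet[m] S) {c : ℝ} (hc : ∀ x ∈ S, |h x| ≤ c) :
    ∫ x in S, h x * (u x - a x) ∂ν = 0 := by
  have hsm : StronglyMeasurable[m] (S.indicator h) := (hh.indicator hS).stronglyMeasurable
  have hb : ∀ᵐ x ∂ν, ‖S.indicator h x‖ ≤ max c 0 := ae_of_all _ fun x => by
    by_cases hx : x ∈ S
    · simpa [hx] using Or.inl (hc x hx)
    · simp [hx]
  have hpull := condExp_stronglyMeasurable_mul_of_bound hm hsm hu _ hb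
  have hI : ∀ g : Ω → ℝ, Integrable g ν → Integrable (fun x => S.indicator h x * g x) ν :=
    fun g hg => Integrable.bdd_mul hg (hsm.mono hm).aestronglyMeasurable hb
  calc ∫ x in S, h x * (u x - a x) ∂ν
      = ∫ x, (S.indicator h x * u x - S.indicator h x * a x) ∂ν := by
        rw [← integral_indicator (hm _ hS)]
        refine integral_congr_ae (ae_of_all _ fun x => ?_)
        by_cases hx : x ∈ S <;> simp [hx, mul_sub]
    _ = ∫ x, S.indicator h x * u x ∂ν - ∫ x, S.indicator h x * a x ∂ν :=
        integral_sub (hI u hu) (hI a (integrable_condExp.congr ha.symm))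
    _ = 0 := by
        rw [sub_eq_zero, ← integral_condExp hm]
        refine integral_congr_ae ?_
        filter_upwards [hpull, ha] with x hx hax
        rw [hax]
        exact hx

lemma ae_eq_zero_of_condExp_eq_zero [IsFiniteMeasure ν] (hm : m ≤ m0) (hu : Integrable u ν)
    (hu0 : 0 ≤ᵐ[ν] u) (ha : a =ᵐ[ν] ν[u|m]) (ham : Measurable[m] a) :
    ∀ᵐ x ∂ν, a x = 0 → u x = 0 := by
  have hS : MeasurableSet[m] {x | a x = 0} := ham (measurableSet_singleton 0)
  have h1 : ∫ x in {x | a x = 0}, u x ∂ν = 0 := by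
    rw [← setIntegral_condExp hm hu hS]
    refine setIntegral_eq_zero_of_ae_eq_zero ?_
    filter_upwards [ha] with x hx hx0
    rw [← hx]
    exact hx0
  rw [setIntegral_eq_zero_iff_of_nonneg_ae (ae_restrict_of_ae hu0) hu.integrableOn,
    EventuallyEq, ae_restrict_iff' (hm _ hS)] at h1
  exact h1

lemma condExp_ae_eq_zero_on [IsFiniteMeasure ν] (hm : m ≤ m0) (hu : Integrable u ν)
    (hu0 : 0 ≤ᵐ[ν] u) (ha : a =ᵐ[ν] ν[u|m]) {S : Set Ω} (hS : MeasurableSet[m] S)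
    (h0 : ∀ᵐ x ∂ν, x ∈ S → u x = 0) : ∀ᵐ x ∂ν, x ∈ S → a x = 0 := by
  have ha0 : 0 ≤ᵐ[ν] a := (condExp_nonneg hu0).trans ha.symm.le
  have h1 : ∫ x in S, a x ∂ν = 0 := by
    rw [integral_congr_ae (ae_restrict_of_ae ha), setIntegral_condExp hm hu hS]
    exact setIntegral_eq_zero_of_ae_eq_zero h0
  rwa [setIntegral_eq_zero_iff_of_nonneg_ae (ae_restrict_of_ae ha0)
    (integrable_condExp.congr ha.symm).integrableOn,
    EventuallyEq, ae_restrict_iff' (hm _ hS)] at h1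

lemma ClassF.bregman_nonneg_ae (hf : ClassF f) (hu0 : 0 ≤ᵐ[ν] u) (hv0 : 0 ≤ᵐ[ν] v)
    (hvu : ∀ᵐ x ∂ν, v x = 0 → u x = 0) : ∀ᵐ x ∂ν, 0 ≤ bregman f (u x) (v x) := by
  filter_upwards [hu0, hv0, hvu] with x h1 h2 h3
  rcases h2.eq_or_lt with h | h
  · simp [← h, h3 h.symm, bregman]
  · exact hf.bregman_nonneg h1 h

/-- The mean of the Bregman divergence of `u` and its conditional expectation `a`. -/
lemma ClassF.integral_bregman_condExp [IsFiniteMeasure ν] (hf : ClassF f) (hm : m ≤ m0)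
    (hu : Integrable u ν) (hu0 : 0 ≤ᵐ[ν] u) (ha : a =ᵐ[ν] ν[u|m]) (ham : Measurable[m] a)
    (hfu : Integrable (fun x => f (u x)) ν) (hfa : Integrable (fun x => f (a x)) ν) :
    Integrable (fun x => bregman f (u x) (a x)) ν ∧
      ∫ x, bregman f (u x) (a x) ∂ν = ∫ x, f (u x) ∂ν - ∫ x, f (a x) ∂ν := by
  have ha0 : 0 ≤ᵐ[ν] a := (condExp_nonneg hu0).trans ha.symm.le
  have hdm : Measurable[m] fun x => deriv f (a x) := (measurable_deriv f).comp ham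
  have hcov := aecover_abs_le (ν := ν) (hdm.mono hm le_rfl)
  have hS : ∀ N : ℕ, MeasurableSet[m] {x | |deriv f (a x)| ≤ N} := fun N =>
    (measurableSet_le measurable_id.abs measurable_const : MeasurableSet {t : ℝ | |t| ≤ N}).preimage
      hdm
  have hint1 := fun N : ℕ => integrableOn_mul_sub_condExp hm hu ha hdm (hS N) (c := N)
    fun x hx => hx
  have hint0 := fun N : ℕ => setIntegral_mul_sub_condExp hm hu ha hdm (hS N) (c := N)
    fun x hx => hx
  have hfs : Integrable (fun x => f (u x) - f (a x)) ν := hfu.sub hfa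
  have hintB : ∀ N : ℕ, IntegrableOn (fun x => bregman f (u x) (a x))
      {x | |deriv f (a x)| ≤ N} ν := fun N => hfs.integrableOn.sub (hint1 N)
  have hval : ∀ N : ℕ, ∫ x in {x | |deriv f (a x)| ≤ N}, bregman f (u x) (a x) ∂ν =
      ∫ x in {x | |deriv f (a x)| ≤ N}, (f (u x) - f (a x)) ∂ν := fun N => by
    unfold bregman
    rw [integral_sub hfs.integrableOn (hint1 N), hint0 N, sub_zero]
  have hlim := hcov.integral_tendsto_of_countably_generated hfs
  -- Nonnegativity turns convergence of the integrals over level sets into integrability on the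
  -- whole space.
  have hnn := hf.bregman_nonneg_ae hu0 ha0 (ae_eq_zero_of_condExp_eq_zero hm hu hu0 ha ham)
  simp_rw [← hval] at hlim
  refine ⟨hcov.integrable_of_integral_tendsto_of_nonneg_ae _ hintB hnn hlim, ?_⟩
  rw [hcov.integral_eq_of_tendsto_of_nonneg_ae _ hnn hintB hlim, integral_sub hfu hfa]

/-- The data processing inequality for the mean Bregman divergence. -/
lemma ClassF.integral_bregman_condExp_le [IsFiniteMeasure ν] (hf : ClassF f)
    (hfm : Measurable f) (hm : m ≤ m0)
    (hu : Integrable u ν) (hu0 : 0 ≤ᵐ[ν] u) (hv : Integrable v ν) (hv0 : 0 ≤ᵐ[ν] v)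
    (hvu : ∀ᵐ x ∂ν, v x = 0 → u x = 0)
    (ha : a =ᵐ[ν] ν[u|m]) (ham : Measurable[m] a) (hb : b =ᵐ[ν] ν[v|m]) (hbm : Measurable[m] b)
    (hB : Integrable (fun x => bregman f (u x) (v x)) ν) :
    ∫ x, bregman f (a x) (b x) ∂ν ≤ ∫ x, bregman f (u x) (v x) ∂ν := by
  have ha0 : 0 ≤ᵐ[ν] a := (condExp_nonneg hu0).trans ha.symm.le
  have hb0 : 0 ≤ᵐ[ν] b := (condExp_nonneg hv0).trans hb.symm.le
  have hau := ae_eq_zero_of_condExp_eq_zero hm hu hu0 ha ham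
  have hbv := ae_eq_zero_of_condExp_eq_zero hm hv hv0 hb hbm
  have hba : ∀ᵐ x ∂ν, b x = 0 → a x = 0 := by
    refine condExp_ae_eq_zero_on hm hu hu0 ha (S := {x | b x = 0})
      (hbm (measurableSet_singleton 0)) ?_
    filter_upwards [hvu, hbv] with x h1 h2 h3 using h1 (h2 h3)
  have hm1 : Measurable[m] fun x => deriv f (a x) - deriv f (b x) :=
    ((measurable_deriv f).comp ham).sub ((measurable_deriv f).comp hbm)
  have hm2 : Measurable[m] fun x => deriv (deriv f) (b x) * (a x - b x) :=
    ((measurable_deriv _).comp hbm).mul (ham.sub hbm)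
  have hm3 : Measurable[m] fun x => bregman f (a x) (b x) :=
    ((hfm.comp ham).sub (hfm.comp hbm)).sub (((measurable_deriv f).comp hbm).mul (ham.sub hbm))
  have hm4 : Measurable[m] fun x => |deriv f (a x) - deriv f (b x)| +
      |deriv (deriv f) (b x) * (a x - b x)| + |bregman f (a x) (b x)| :=
    ((continuous_abs.measurable.comp hm1).add (continuous_abs.measurable.comp hm2)).add
      (continuous_abs.measurable.comp hm3)
  -- Bounding this sum bounds both slopes of the tangent plane and its value at (a, b), so one
  -- m-measurable truncation serves all three.
  set g : Ω → ℝ := fun x => |deriv f (a x) - deriv f (b x)| +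
      |deriv (deriv f) (b x) * (a x - b x)| + |bregman f (a x) (b x)| with hg
  have hcov := aecover_abs_le (ν := ν) (hm4.mono hm le_rfl)
  have hS : ∀ N : ℕ, MeasurableSet[m] {x | |g x| ≤ N} := fun N =>
    (measurableSet_le measurable_id.abs measurable_const : MeasurableSet {t : ℝ | |t| ≤ N}).preimage
      hm4
  have hle : ∀ (N : ℕ), ∀ x ∈ {x | |g x| ≤ N}, |deriv f (a x) - deriv f (b x)| ≤ N ∧
      |deriv (deriv f) (b x) * (a x - b x)| ≤ N ∧ |bregman f (a x) (b x)| ≤ N := by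
    intro N x hx
    have h1 := (le_abs_self (g x)).trans hx
    simp only [hg] at h1
    have := abs_nonneg (deriv f (a x) - deriv f (b x))
    have := abs_nonneg (deriv (deriv f) (b x) * (a x - b x))
    have := abs_nonneg (bregman f (a x) (b x))
    refine ⟨?_, ?_, ?_⟩ <;> linarith
  have hnn := hf.bregman_nonneg_ae hu0 hv0 hvu
  have hnn' := hf.bregman_nonneg_ae ha0 hb0 hba
  have hint : ∀ N : ℕ, IntegrableOn (fun x => bregman f (a x) (b x)) {x | |g x| ≤ N} ν := by
    intro N
    refine Measure.integrableOn_of_bounded (M := N) (measure_ne_top _ _)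
      (hm3.mono hm le_rfl).aestronglyMeasurable ?_
    filter_upwards [ae_restrict_mem (hm _ (hS N))] with x hx using (hle N x hx).2.2
  have hbound : ∀ N : ℕ, ∫ x in {x | |g x| ≤ N}, bregman f (a x) (b x) ∂ν ≤
      ∫ x, bregman f (u x) (v x) ∂ν := by
    intro N
    have i1 := integrableOn_mul_sub_condExp hm hu ha hm1 (hS N) (c := N) fun x hx => (hle N x hx).1
    have i2 := integrableOn_mul_sub_condExp hm hv hb hm2 (hS N) (c := N)
      fun x hx => (hle N x hx).2.1
    have z1 := setIntegral_mul_sub_condExp hm hu ha hm1 (hS N) (c := N) fun x hx => (hle N x hx).1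
    have z2 := setIntegral_mul_sub_condExp hm hv hb hm2 (hS N) (c := N)
      fun x hx => (hle N x hx).2.1
    -- The linear terms of the tangent plane at (a, b) integrate to zero over the truncation set,
    -- and the plane lies below B(u, v).
    calc ∫ x in {x | |g x| ≤ N}, bregman f (a x) (b x) ∂ν
        = ∫ x in {x | |g x| ≤ N}, bregmanTangent f (a x) (b x) (u x) (v x) ∂ν := by
          unfold bregmanTangent
          rw [integral_sub _ i2, integral_add (hint N) i1, z1, z2, add_zero, sub_zero]
          exact (hint N).add i1
      _ ≤ ∫ x in {x | |g x| ≤ N}, bregman f (u x) (v x) ∂ν := by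
          refine integral_mono_ae (((hint N).add i1).sub i2) hB.integrableOn (ae_restrict_of_ae ?_)
          filter_upwards [hu0, hv0, ha0, hb0, hvu, hau, hbv, hba] with x h1 h2 h3 h4 h5 h6 h7 h8
            using hf.bregmanTangent_le h3 h4 h1 h2 h5 h6 h7 h8
      _ ≤ ∫ x, bregman f (u x) (v x) ∂ν := setIntegral_le_integral hB hnn
  have hI := hcov.integrable_of_integral_bounded_of_nonneg_ae _ hint hnn'
    (Eventually.of_forall hbound)
  exact le_of_tendsto (hcov.integral_tendsto_of_countably_generated hI)
    (Eventually.of_forall hbound)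

end CondExp

/-! ### Resampling a coordinate of an i.i.d. family -/

section Resampling

variable {ι α : Type*} [DecidableEq ι] [MeasurableSpace α]

lemma measurable_update_pair (k : ι) :
    Measurable fun p : α × (ι → α) => Function.update p.2 k p.1 := by
  refine measurable_pi_lambda _ fun i => ?_
  by_cases h : i = k
  · subst h; simpa using measurable_fst
  · simp only [Function.update_of_ne h]; fun_prop

/-- Replacing one coordinate of an i.i.d. family by an independent copy preserves the law. -/
lemma measurePreserving_update [Fintype ι] (P : Measure α) [IsProbabilityMeasure P] (k : ι) :
    MeasurePreserving (fun p : α × (ι → α) => Function.update p.2 k p.1)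
      (P.prod (Measure.pi fun _ : ι => P)) (Measure.pi fun _ : ι => P) := by
  refine ⟨measurable_update_pair k, (Measure.pi_eq fun s hs => ?_).symm⟩
  rw [Measure.map_apply (measurable_update_pair k) (MeasurableSet.univ_pi hs)]
  have : (fun p : α × (ι → α) => Function.update p.2 k p.1) ⁻¹' (univ.pi s) =
      s k ×ˢ univ.pi (Function.update s k univ) := by
    ext p
    simp only [mem_preimage, Set.mem_pi, mem_univ, true_implies, mem_prod]
    constructor
    · refine fun h => ⟨by simpa using h k, fun i => ?_⟩
      by_cases hi : i = k
      · subst hi; simp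
      · simpa [Function.update_of_ne hi] using h i
    · rintro ⟨h1, h2⟩ i
      by_cases hi : i = k
      · subst hi; simpa using h1
      · simpa [Function.update_of_ne hi] using h2 i
  rw [this, Measure.prod_prod, Measure.pi_pi, ← Finset.mul_prod_erase _ _ (Finset.mem_univ k),
    ← Finset.mul_prod_erase Finset.univ (fun i => P (s i)) (Finset.mem_univ k)]
  simp only [Function.update_self, measure_univ, one_mul]
  congr 1
  refine Finset.prod_congr rfl fun i hi => ?_
  rw [Function.update_of_ne (Finset.ne_of_mem_erase hi)]

end Resampling

/-! ### The filtration of source prefixes -/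

section Prefix

variable {α γ : Type*} [MeasurableSpace α] [MeasurableSpace γ] {n : ℕ}

/-- The first `k` coordinates of the first component, together with the second component. -/
def prefixMap (n k : ℕ) (z : (Fin n → α) × γ) : ({i : Fin n // (i : ℕ) < k} → α) × γ :=
  (fun i => z.1 i, z.2)

/-- The `σ`-algebra generated by `prefixMap n k`. -/
abbrev prefixAlgebra (α γ : Type*) [MeasurableSpace α] [MeasurableSpace γ] (n k : ℕ) :
    MeasurableSpace ((Fin n → α) × γ) :=
  MeasurableSpace.comap (prefixMap n k) inferInstance

lemma measurable_prefixMap (n k : ℕ) :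
    Measurable (prefixMap n k : (Fin n → α) × γ → _) := by
  unfold prefixMap; fun_prop

lemma prefixAlgebra_le (n k : ℕ) : prefixAlgebra α γ n k ≤ Prod.instMeasurableSpace :=
  (measurable_prefixMap n k).comap_le

lemma measurable_prefixMap_self (n k : ℕ) :
    Measurable[prefixAlgebra α γ n k] (prefixMap n k : (Fin n → α) × γ → _) :=
  comap_measurable _

lemma measurable_prefixAlgebra_of_eq_comp {δ : Type*} [MeasurableSpace δ] {k : ℕ}
    {h : (Fin n → α) × γ → δ} {g : ({i : Fin n // (i : ℕ) < k} → α) × γ → δ} (hg : Measurable g)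
    (hgh : h = g ∘ prefixMap n k) : Measurable[prefixAlgebra α γ n k] h :=
  hgh ▸ hg.comp (measurable_prefixMap_self n k)

lemma prefixAlgebra_mono {k l : ℕ} (hkl : k ≤ l) : prefixAlgebra α γ n k ≤ prefixAlgebra α γ n l :=
  Measurable.comap_le (measurable_prefixAlgebra_of_eq_comp
    (g := fun w => (fun i => w.1 ⟨i.1, i.2.trans_le hkl⟩, w.2)) (by fun_prop) rfl)

lemma prefixAlgebra_self : prefixAlgebra α γ n n = Prod.instMeasurableSpace := by
  refine le_antisymm (prefixAlgebra_le n n) ?_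
  have h : Measurable[prefixAlgebra α γ n n] (id : (Fin n → α) × γ → _) :=
    measurable_prefixAlgebra_of_eq_comp (g := fun w => (fun i => w.1 ⟨i, i.2⟩, w.2))
      (by fun_prop) rfl
  exact fun s hs => h hs

lemma prefixAlgebra_zero :
    prefixAlgebra α γ n 0 = MeasurableSpace.comap Prod.snd inferInstance := by
  refine le_antisymm ?_ ?_
  · refine Measurable.comap_le ?_
    have : (prefixMap n 0 : (Fin n → α) × γ → _) =
        (fun y => (fun i => absurd i.2 (Nat.not_lt_zero _), y)) ∘ Prod.snd := by
      ext z i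
      · exact absurd i.2 (Nat.not_lt_zero _)
      · rfl
    rw [this]
    refine Measurable.comp ?_ (comap_measurable _)
    exact Measurable.prodMk (measurable_pi_lambda _ fun i => absurd i.2 (Nat.not_lt_zero _))
      measurable_id
  · exact Measurable.comap_le (measurable_prefixAlgebra_of_eq_comp measurable_snd rfl)

lemma measurable_prefixAlgebra_snd (k : ℕ) :
    Measurable[prefixAlgebra α γ n k] (Prod.snd : (Fin n → α) × γ → γ) :=
  measurable_prefixAlgebra_of_eq_comp measurable_snd rfl

lemma measurable_prefixAlgebra_coord {i : Fin n} {k : ℕ} (hik : (i : ℕ) < k) :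
    Measurable[prefixAlgebra α γ n k] (fun z : (Fin n → α) × γ => z.1 i) :=
  measurable_prefixAlgebra_of_eq_comp (g := fun w => w.1 ⟨i, hik⟩) (by fun_prop) rfl

variable (P : Measure α) [IsProbabilityMeasure P] (Q : Measure γ) [IsProbabilityMeasure Q]

/-- Resampling coordinate k independently preserves the product law and does not move `prefixMap n
k`, which sees only the coordinates strictly below k. -/
lemma indep_coord_prefixAlgebra (k : Fin n) :
    Indep (MeasurableSpace.comap (fun z : (Fin n → α) × γ => z.1 k) inferInstance)
      (prefixAlgebra α γ n k) ((Measure.pi fun _ : Fin n => P).prod Q) := by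
  rw [Indep_iff]
  rintro _ _ ⟨A, hA, rfl⟩ ⟨T, hT, rfl⟩
  set ν := (Measure.pi fun _ : Fin n => P).prod Q
  have hT' := measurable_prefixMap (α := α) (γ := γ) n k hT
  have hmp : MeasurePreserving
      (Prod.map (fun p : α × (Fin n → α) => Function.update p.2 k p.1) (id : γ → γ))
      ((P.prod (Measure.pi fun _ : Fin n => P)).prod Q) ν :=
    (measurePreserving_update P k).prod (MeasurePreserving.id Q)
  have hassoc : MeasurePreserving (MeasurableEquiv.prodAssoc : (α × (Fin n → α)) × γ ≃ᵐ _)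
      ((P.prod (Measure.pi fun _ : Fin n => P)).prod Q) (P.prod ν) :=
    measurePreserving_prodAssoc _ _ _
  have key : ∀ A : Set α, MeasurableSet A →
      ν ((fun z : (Fin n → α) × γ => z.1 k) ⁻¹' A ∩ prefixMap n k ⁻¹' T) =
        P A * ν (prefixMap n k ⁻¹' T) := by
    intro A hA
    have hA' : MeasurableSet ((fun z : (Fin n → α) × γ => z.1 k) ⁻¹' A) :=
      (by fun_prop : Measurable fun z : (Fin n → α) × γ => z.1 k) hA
    rw [← Measure.prod_prod, ← hassoc.measure_preimage (hA.prod hT').nullMeasurableSet,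
      ← hmp.measure_preimage (hA'.inter hT').nullMeasurableSet]
    congr 1
    ext ⟨⟨x, z⟩, y⟩
    have : prefixMap n k (Function.update z k x, y) = prefixMap n k (z, y) := by
      refine Prod.ext (funext fun i => ?_) rfl
      exact Function.update_of_ne (fun h => absurd i.2 (by simp [h])) _ _
    simp [MeasurableEquiv.prodAssoc, this]
  rw [key A hA]
  congr 1
  have h1 := measurePreserving_eval (fun _ : Fin n => P) k
  have h2 : MeasurePreserving (Prod.fst : (Fin n → α) × γ → _) ν (Measure.pi fun _ : Fin n => P) :=
    measurePreserving_fst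
  exact ((h1.comp h2).measure_preimage hA.nullMeasurableSet).symm

lemma setLIntegral_coord_of_measurable_prefixAlgebra (k : Fin n) {A : Set α} (hA : MeasurableSet A)
    {h : (Fin n → α) × γ → ℝ≥0∞} (hh : Measurable[prefixAlgebra α γ n k] h) :
    ∫⁻ z in (fun z => z.1 k) ⁻¹' A, h z ∂((Measure.pi fun _ : Fin n => P).prod Q) =
      P A * ∫⁻ z, h z ∂((Measure.pi fun _ : Fin n => P).prod Q) := by
  set ν := (Measure.pi fun _ : Fin n => P).prod Q
  have hX : Measurable fun z : (Fin n → α) × γ => z.1 k := by fun_prop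
  have hmeas : Measurable[MeasurableSpace.comap (fun z : (Fin n → α) × γ => z.1 k) inferInstance]
      ((A.indicator (1 : α → ℝ≥0∞)) ∘ fun z : (Fin n → α) × γ => z.1 k) :=
    (measurable_one.indicator hA).comp (comap_measurable _)
  have := lintegral_mul_eq_lintegral_mul_lintegral_of_independent_measurableSpace
    hX.comap_le (prefixAlgebra_le n k) (indep_coord_prefixAlgebra P Q k) hmeas hh
  have h1 : MeasurePreserving (fun z : (Fin n → α) × γ => z.1 k) ν P :=
    (measurePreserving_eval (fun _ : Fin n => P) k).comp measurePreserving_fst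
  simp only [Function.comp_apply] at this
  rw [h1.lintegral_comp (measurable_one.indicator hA), lintegral_indicator_one hA] at this
  rw [← this, ← lintegral_indicator (hX hA)]
  refine lintegral_congr fun z => ?_
  by_cases hz : z.1 k ∈ A <;> simp [hz]

end Prefix

/-! ### Conditional expectations of densities -/

section RnDeriv

variable {Ω : Type*} {m m0 : MeasurableSpace Ω} {μ ν : Measure Ω}

/-- The conditional expectation given `m` is the density of μ restricted to `m`. -/
lemma setLIntegral_condExp_rnDeriv [IsFiniteMeasure μ] [IsFiniteMeasure ν] (hm : m ≤ m0)
    (hμν : μ ≪ ν) {S : Set Ω} (hS : MeasurableSet[m] S) :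
    ∫⁻ x in S, ENNReal.ofReal ((ν[fun x => (μ.rnDeriv ν x).toReal | m]) x) ∂ν = μ S := by
  rw [← ofReal_integral_eq_lintegral_ofReal integrable_condExp.integrableOn
    (ae_restrict_of_ae (condExp_nonneg (ae_of_all _ fun _ => ENNReal.toReal_nonneg))),
    setIntegral_condExp hm Measure.integrable_toReal_rnDeriv hS,
    Measure.setIntegral_toReal_rnDeriv hμν, ofReal_measureReal]

end RnDeriv

/-! ### Adjoining a uniform index -/

section Uniform

variable {Ω Z : Type*} [MeasurableSpace Ω] [MeasurableSpace Z] {n : ℕ}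

/-- The uniform distribution on `Fin n`. -/
noncomputable def uniformFin (n : ℕ) : Measure (Fin n) := (n : ℝ≥0∞)⁻¹ • Measure.count

instance isFiniteMeasure_uniformFin [NeZero n] : IsFiniteMeasure (uniformFin n) := by
  unfold uniformFin
  exact Measure.smul_finite _ (by simp [NeZero.ne n])

lemma measurable_uncurry_fin {w : Fin n → Ω → Z} (hw : ∀ k, Measurable (w k)) :
    Measurable fun p : Fin n × Ω => w p.1 p.2 :=
  measurable_from_prod_countable_right hw

lemma lintegral_uniformFin_prod [NeZero n] (ν : Measure Ω) [SFinite ν] {w : Fin n → Ω → ℝ≥0∞}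
    (hw : ∀ k, Measurable (w k)) :
    ∫⁻ p, w p.1 p.2 ∂((uniformFin n).prod ν) = (n : ℝ≥0∞)⁻¹ * ∑ k, ∫⁻ z, w k z ∂ν := by
  rw [lintegral_prod _ (measurable_uncurry_fin hw).aemeasurable, uniformFin,
    lintegral_smul_measure, lintegral_count, tsum_fintype, smul_eq_mul]

lemma integrable_uniformFin_prod [NeZero n] {ν : Measure Ω} [SFinite ν] {w : Fin n → Ω → ℝ}
    (hw : ∀ k, Measurable (w k)) (hi : ∀ k, Integrable (w k) ν) :
    Integrable (fun p => w p.1 p.2) ((uniformFin n).prod ν) := by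
  rw [integrable_prod_iff (measurable_uncurry_fin hw).aestronglyMeasurable]
  exact ⟨ae_of_all _ hi, Integrable.of_finite⟩

lemma integral_uniformFin_prod [NeZero n] {ν : Measure Ω} [SFinite ν] {w : Fin n → Ω → ℝ}
    (hw : ∀ k, Measurable (w k)) (hi : ∀ k, Integrable (w k) ν) :
    ∫ p, w p.1 p.2 ∂((uniformFin n).prod ν) = (n : ℝ)⁻¹ * ∑ k, ∫ z, w k z ∂ν := by
  rw [integral_prod _ (integrable_uniformFin_prod hw hi), uniformFin, integral_smul_measure,
    integral_count]
  simp

/-- Presents an average of n images as one image from `Fin n × Ω`, so that a single data processing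
step handles superadditivity and averaging together. -/
lemma map_withDensity_uniformFin_prod [NeZero n] (ν : Measure Ω) [SFinite ν]
    {w : Fin n → Ω → ℝ≥0∞} (hw : ∀ k, Measurable (w k)) {π : Fin n → Ω → Z}
    (hπ : ∀ k, Measurable (π k)) :
    (((uniformFin n).prod ν).withDensity fun p => w p.1 p.2).map (fun p => π p.1 p.2) =
      (n : ℝ≥0∞)⁻¹ • ∑ k, (ν.withDensity (w k)).map (π k) := by
  ext S hS
  have hw' : ∀ k, Measurable ((π k ⁻¹' S).indicator (w k)) := fun k =>
    (hw k).indicator (hπ k hS)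
  rw [Measure.map_apply (measurable_uncurry_fin hπ) hS,
    withDensity_apply _ (measurable_uncurry_fin hπ hS),
    ← lintegral_indicator (measurable_uncurry_fin hπ hS)]
  have : ((fun p : Fin n × Ω => π p.1 p.2) ⁻¹' S).indicator (fun p => w p.1 p.2) =
      fun p => (π p.1 ⁻¹' S).indicator (w p.1) p.2 := rfl
  rw [this, lintegral_uniformFin_prod ν hw', Measure.smul_apply, Measure.finsetSum_apply,
    smul_eq_mul]
  congr 1
  refine Finset.sum_congr rfl fun k _ => ?_
  rw [lintegral_indicator (hπ k hS), Measure.map_apply (hπ k) hS, withDensity_apply _ (hπ k hS)]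

end Uniform

/-! ### Data processing for the divergence difference -/

section Convexity

variable {f : ℝ → ℝ}

/-- If `π` maps `ν`, `u • ν` and `v • ν` to `P × Q`, `μ` and `P × μ_B`, then the difference
`D_f(μ ‖ P × Q) - D_f(μ_B ‖ Q)` is at most the mean Bregman divergence of `u` and `v`. -/
lemma ClassF.integral_sub_le_integral_bregman (hf : ClassF f) (hfm : Measurable f)
    {Ω A B : Type*} [MeasurableSpace Ω] [MeasurableSpace A] [MeasurableSpace B]
    {ν : Measure Ω} [IsFiniteMeasure ν] {u v : Ω → ℝ} (hum : Measurable u) (hvm : Measurable v)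
    (hu : Integrable u ν) (hu0 : 0 ≤ᵐ[ν] u) (hv : Integrable v ν) (hv0 : 0 ≤ᵐ[ν] v)
    (hvu : ∀ᵐ x ∂ν, v x = 0 → u x = 0) (hfu : Integrable (fun x => f (u x)) ν)
    (hB : Integrable (fun x => bregman f (u x) (v x)) ν)
    {π : Ω → A × B} (hπ : Measurable π) {P : Measure A} [IsProbabilityMeasure P]
    {Q : Measure B} [IsFiniteMeasure Q] {μ : Measure (A × B)} [IsFiniteMeasure μ]
    (hν : ν.map π = P.prod Q) (hμ : (ν.withDensity fun x => ENNReal.ofReal (u x)).map π = μ)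
    (hμ' : (ν.withDensity fun x => ENNReal.ofReal (v x)).map π = P.prod μ.snd) :
    (μ ≪ P.prod Q ∧ Integrable (fun z => f (μ.rnDeriv (P.prod Q) z).toReal) (P.prod Q)) ∧
    (μ.snd ≪ Q ∧ Integrable (fun y => f (μ.snd.rnDeriv Q y).toReal) Q) ∧
    ∫ z, f (μ.rnDeriv (P.prod Q) z).toReal ∂(P.prod Q) - ∫ y, f (μ.snd.rnDeriv Q y).toReal ∂Q ≤
      ∫ x, bregman f (u x) (v x) ∂ν := by
  have hfc := hf.convexOn
  have hf0 := hf.continuousWithinAt_zero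
  set M₁ := ν.withDensity fun x => ENNReal.ofReal (u x)
  set M₂ := ν.withDensity fun x => ENNReal.ofReal (v x)
  have hM₁ : M₁ ≪ ν := withDensity_absolutelyContinuous _ _
  have hM₂ : M₂ ≪ ν := withDensity_absolutelyContinuous _ _
  have : IsFiniteMeasure M₁ := isFiniteMeasure_withDensity_ofReal hu.2
  have : IsFiniteMeasure M₂ := isFiniteMeasure_withDensity_ofReal hv.2
  have hd : ∀ w : Ω → ℝ, Measurable w → 0 ≤ᵐ[ν] w →
      (fun x => ((ν.withDensity fun x => ENNReal.ofReal (w x)).rnDeriv ν x).toReal) =ᵐ[ν] w := by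
    intro w hw hw0
    filter_upwards [Measure.rnDeriv_withDensity ν hw.ennreal_ofReal, hw0] with x h1 h2
    rw [h1, ENNReal.toReal_ofReal h2]
  have hd₁ := hd u hum hu0
  have hd₂ := hd v hvm hv0
  have hac : μ ≪ P.prod Q := by rw [← hμ, ← hν]; exact hM₁.map hπ
  have hsnd : (P.prod Q).map Prod.snd = Q := Measure.snd_prod
  have hac' : μ.snd ≪ Q := by
    have := hac.map measurable_snd
    rwa [hsnd] at this
  have hfs : StronglyMeasurable f := hfm.stronglyMeasurable
  have hint : Integrable (fun z => f (μ.rnDeriv (P.prod Q) z).toReal) (P.prod Q) := by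
    have := hfc.integrable_comp_rnDeriv_map hM₁ hπ hfs hf0
      (hfu.congr (by filter_upwards [hd₁] with x hx; rw [hx]))
    rwa [hμ, hν] at this
  have hint' : Integrable (fun y => f (μ.snd.rnDeriv Q y).toReal) Q := by
    have := hfc.integrable_comp_rnDeriv_map hac measurable_snd hfs hf0 hint
    rwa [hsnd] at this
  refine ⟨⟨hac, hint⟩, ⟨hac', hint'⟩, ?_⟩
  set a : A × B → ℝ := fun z => (μ.rnDeriv (P.prod Q) z).toReal with ha
  set b : B → ℝ := fun y => (μ.snd.rnDeriv Q y).toReal with hb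
  have ham : Measurable a := (Measure.measurable_rnDeriv _ _).ennreal_toReal
  have hbm : Measurable b := (Measure.measurable_rnDeriv _ _).ennreal_toReal
  -- This lets `ClassF.integral_bregman_condExp` identify the divergence difference with the mean of
  -- B(a, b).
  have hba : (fun z : A × B => b z.2) =ᵐ[P.prod Q]
      (P.prod Q)[a | MeasurableSpace.comap Prod.snd inferInstance] := by
    have : SigmaFinite ((P.prod Q).map Prod.snd) := by rw [hsnd]; infer_instance
    have := toReal_rnDeriv_map hac measurable_snd
    rwa [hsnd] at this
  have hb2 : (fun z => ((P.prod μ.snd).rnDeriv (P.prod Q) z).toReal) =ᵐ[P.prod Q]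
      fun z => b z.2 := by
    have h1 : P.prod μ.snd = (P.prod Q).withDensity fun z => μ.snd.rnDeriv Q z.2 := by
      rw [← prod_withDensity_right (Measure.measurable_rnDeriv _ _),
        Measure.withDensity_rnDeriv_eq _ _ hac']
    have h2 := Measure.rnDeriv_withDensity (P.prod Q)
      ((Measure.measurable_rnDeriv μ.snd Q).comp (measurable_snd (α := A)))
    simp only [Function.comp_def] at h2
    rw [← h1] at h2
    filter_upwards [h2] with z hz
    rw [hz]
  -- Densities of image measures, pulled back along π, are conditional expectations given π.
  have haπ : (fun x => a (π x)) =ᵐ[ν] ν[u | MeasurableSpace.comap π inferInstance] := by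
    have := toReal_rnDeriv_map hM₁ hπ
    rw [hμ, hν] at this
    exact this.trans (condExp_congr_ae hd₁)
  have hbπ : (fun x => b (π x).2) =ᵐ[ν] ν[v | MeasurableSpace.comap π inferInstance] := by
    have := toReal_rnDeriv_map hM₂ hπ
    rw [hμ', hν] at this
    refine EventuallyEq.trans ?_ (this.trans (condExp_congr_ae hd₂))
    have hq : Measure.QuasiMeasurePreserving π ν (P.prod Q) := ⟨hπ, hν.le.absolutelyContinuous⟩
    filter_upwards [hq.ae hb2] with x hx using hx.symm
  have hdpi := hf.integral_bregman_condExp_le hfm hπ.comap_le hu hu0 hv hv0 hvu haπ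
    (ham.comp (comap_measurable π)) hbπ ((hbm.comp measurable_snd).comp (comap_measurable π)) hB
  refine le_trans (le_of_eq ?_) hdpi
  have hbreg : Measurable fun z => bregman f (a z) (b z.2) := by
    have := (measurable_deriv f)
    unfold bregman
    fun_prop
  have e1 : ∫ x, bregman f (a (π x)) (b (π x).2) ∂ν =
      ∫ z, bregman f (a z) (b z.2) ∂(P.prod Q) := by
    rw [← hν, integral_map hπ.aemeasurable hbreg.aestronglyMeasurable]
  have hint'' : Integrable (fun z : A × B => f (b z.2)) (P.prod Q) :=
    measurePreserving_snd.integrable_comp_of_integrable hint'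
  have e2 : ∫ z : A × B, f (b z.2) ∂(P.prod Q) = ∫ y, f (b y) ∂Q := by
    have := integral_map (μ := P.prod Q) measurable_snd.aemeasurable (f := fun y => f (b y))
      (hfm.comp hbm).aestronglyMeasurable
    rw [hsnd] at this
    exact this.symm
  rw [e1, (hf.integral_bregman_condExp measurable_snd.comap_le Measure.integrable_toReal_rnDeriv
    (ae_of_all _ fun _ => ENNReal.toReal_nonneg) hba (hbm.comp (comap_measurable _))
    hint hint'').2, e2]

end Convexity

/-! ### Averages of measures -/

section Average

variable {α β : Type*} [MeasurableSpace α] [MeasurableSpace β] {n : ℕ}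

/-- The average of `n` measures. -/
noncomputable def avg (μ : Fin n → Measure α) : Measure α := (n : ℝ≥0∞)⁻¹ • ∑ k, μ k

lemma avg_apply (μ : Fin n → Measure α) (s : Set α) :
    avg μ s = (n : ℝ≥0∞)⁻¹ * ∑ k, μ k s := by
  simp [avg]

instance isProbabilityMeasure_avg [NeZero n] (μ : Fin n → Measure α)
    [∀ k, IsProbabilityMeasure (μ k)] : IsProbabilityMeasure (avg μ) :=
  ⟨by simp [avg_apply, ENNReal.inv_mul_cancel, NeZero.ne n]⟩

lemma lintegral_avg (μ : Fin n → Measure α) (g : α → ℝ≥0∞) :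
    ∫⁻ x, g x ∂(avg μ) = (n : ℝ≥0∞)⁻¹ * ∑ k, ∫⁻ x, g x ∂(μ k) := by
  simp [avg]

lemma map_avg (μ : Fin n → Measure α) {g : α → β} (hg : Measurable g) :
    (avg μ).map g = avg fun k => (μ k).map g := by
  ext s hs
  simp [avg_apply, Measure.map_apply hg hs]

lemma prod_avg [NeZero n] (P : Measure α) [IsProbabilityMeasure P] (Q : Fin n → Measure β)
    [∀ k, IsProbabilityMeasure (Q k)] : P.prod (avg Q) = avg fun k => P.prod (Q k) := by
  refine Measure.prod_eq fun s t _ _ => ?_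
  simp only [avg_apply, Measure.prod_prod, ← Finset.mul_sum]
  ring

end Average

/-! ### From the block to the averaged letter -/

section Letters

variable {α β : Type*} [MeasurableSpace α] [MeasurableSpace β] {n : ℕ}

lemma measurable_letter (k : Fin n) :
    Measurable fun z : (Fin n → α) × (Fin n → β) => (z.1 k, z.2 k) := by fun_prop

instance (μ : Measure ((Fin n → α) × (Fin n → β))) [IsProbabilityMeasure μ] (k : Fin n) :
    IsProbabilityMeasure (letterLaw μ k) :=
  Measure.isProbabilityMeasure_map (measurable_letter k).aemeasurable

lemma isProbabilityMeasure_map_eval (Q : Measure (Fin n → β)) [IsProbabilityMeasure Q]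
    (k : Fin n) : IsProbabilityMeasure (Q.map fun y => y k) :=
  Measure.isProbabilityMeasure_map (measurable_pi_apply k).aemeasurable

lemma snd_letterLaw (μ : Measure ((Fin n → α) × (Fin n → β))) (k : Fin n) :
    (letterLaw μ k).snd = μ.snd.map fun y => y k := by
  rw [letterLaw, Measure.snd, Measure.snd, Measure.map_map measurable_snd (measurable_letter k),
    Measure.map_map (measurable_pi_apply k) measurable_snd]
  rfl

lemma map_prod_letter (P : Measure α) [IsProbabilityMeasure P] (Q : Measure (Fin n → β))
    [IsProbabilityMeasure Q] (k : Fin n) :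
    ((Measure.pi fun _ : Fin n => P).prod Q).map (fun z => (z.1 k, z.2 k)) =
      P.prod (Q.map fun y => y k) := by
  have h1 := measurePreserving_eval (fun _ : Fin n => P) k
  have h := Measure.map_prod_map (Measure.pi fun _ : Fin n => P) Q
    (f := Function.eval k) (g := fun y => y k) h1.measurable (measurable_pi_apply k)
  rw [h1.map_eq] at h
  exact h.symm

variable {P : Measure α} [IsProbabilityMeasure P] {Q : Measure (Fin n → β)}
  [IsProbabilityMeasure Q] {μ : Measure ((Fin n → α) × (Fin n → β))} [IsProbabilityMeasure μ]

/-- The pair (X_k, X̂_k) is measurable for the prefix of length k + 1, where this density still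
represents μ. -/
lemma map_letter_withDensity_succ (hμ : μ ≪ (Measure.pi fun _ : Fin n => P).prod Q) (k : Fin n) :
    ((((Measure.pi fun _ : Fin n => P).prod Q).withDensity fun x => ENNReal.ofReal
      ((((Measure.pi fun _ : Fin n => P).prod Q)[fun x =>
        (μ.rnDeriv ((Measure.pi fun _ : Fin n => P).prod Q) x).toReal |
        prefixAlgebra α (Fin n → β) n (k + 1)]) x)).map fun z => (z.1 k, z.2 k)) =
      letterLaw μ k := by
  ext S hS
  have hπ : Measurable[prefixAlgebra α (Fin n → β) n (k + 1)]
      fun z : (Fin n → α) × (Fin n → β) => (z.1 k, z.2 k) :=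
    (measurable_prefixAlgebra_coord (Nat.lt_succ_self k)).prodMk
      ((measurable_pi_apply k).comp (measurable_prefixAlgebra_snd _))
  rw [Measure.map_apply (measurable_letter k) hS, withDensity_apply _ (measurable_letter k hS),
    setLIntegral_condExp_rnDeriv (prefixAlgebra_le n _) hμ (hπ hS), letterLaw,
    Measure.map_apply (measurable_letter k) hS]

/-- The density involves only coordinates below k and the reproduction, so X_k splits off with law
P, while X̂_k keeps its law under μ. -/
lemma map_letter_withDensity (hμ : μ ≪ (Measure.pi fun _ : Fin n => P).prod Q) (k : Fin n) :
    ((((Measure.pi fun _ : Fin n => P).prod Q).withDensity fun x => ENNReal.ofReal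
      ((((Measure.pi fun _ : Fin n => P).prod Q)[fun x =>
        (μ.rnDeriv ((Measure.pi fun _ : Fin n => P).prod Q) x).toReal |
        prefixAlgebra α (Fin n → β) n k]) x)).map fun z => (z.1 k, z.2 k)) =
      P.prod (letterLaw μ k).snd := by
  rw [snd_letterLaw]
  have := isProbabilityMeasure_map_eval μ.snd k
  refine (Measure.prod_eq fun A B hA hB => ?_).symm
  have hB' : Measurable[prefixAlgebra α (Fin n → β) n k]
      fun z : (Fin n → α) × (Fin n → β) => z.2 k :=
    (measurable_pi_apply k).comp (measurable_prefixAlgebra_snd _)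
  have hpre : (fun z : (Fin n → α) × (Fin n → β) => (z.1 k, z.2 k)) ⁻¹' (A ×ˢ B) =
      (fun z => z.2 k) ⁻¹' B ∩ (fun z => z.1 k) ⁻¹' A := by
    ext z; simp [and_comm]
  have hBm := prefixAlgebra_le n k _ (hB' hB)
  rw [Measure.map_apply (measurable_letter k) (hA.prod hB),
    withDensity_apply _ (measurable_letter k (hA.prod hB)), hpre,
    ← Measure.restrict_restrict hBm, ← lintegral_indicator hBm,
    setLIntegral_coord_of_measurable_prefixAlgebra P Q k hA
      (stronglyMeasurable_condExp.measurable.ennreal_ofReal.indicator (hB' hB)),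
    lintegral_indicator hBm,
    setLIntegral_condExp_rnDeriv (prefixAlgebra_le n _) hμ (hB' hB),
    Measure.map_apply (measurable_pi_apply k) hB, Measure.snd_apply (measurable_pi_apply k hB)]
  rfl

/-- Superadditivity and convexity of `D_f(P_{AB} ‖ P_A × Q_B) - D_f(P_B ‖ Q_B)` combined: the value
at the average of the letter laws is at most `1 / n` times the value at the block law. -/
lemma ClassF.letter_le_block [NeZero n] {f : ℝ → ℝ} (hf : ClassF f) (hfm : Measurable f)
    (hμ : μ ≪ (Measure.pi fun _ : Fin n => P).prod Q)
    (hint : Integrable (fun z => f (μ.rnDeriv ((Measure.pi fun _ : Fin n => P).prod Q) z).toReal)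
      ((Measure.pi fun _ : Fin n => P).prod Q))
    {μ₁ : Measure (α × β)} (hμ₁ : μ₁ = avg (letterLaw μ)) {Q₁ : Measure β}
    (hQ₁ : Q₁ = avg fun k => Q.map fun y => y k) :
    (μ₁ ≪ P.prod Q₁ ∧ Integrable (fun z => f (μ₁.rnDeriv (P.prod Q₁) z).toReal) (P.prod Q₁)) ∧
    (μ₁.snd ≪ Q₁ ∧ Integrable (fun y => f (μ₁.snd.rnDeriv Q₁ y).toReal) Q₁) ∧
    n * (∫ z, f (μ₁.rnDeriv (P.prod Q₁) z).toReal ∂(P.prod Q₁) -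
        ∫ y, f (μ₁.snd.rnDeriv Q₁ y).toReal ∂Q₁) ≤
      ∫ z, f (μ.rnDeriv ((Measure.pi fun _ : Fin n => P).prod Q) z).toReal
        ∂((Measure.pi fun _ : Fin n => P).prod Q) - ∫ y, f (μ.snd.rnDeriv Q y).toReal ∂Q := by
  have hsucc := map_letter_withDensity_succ hμ
  have hself := map_letter_withDensity hμ
  have hprod := map_prod_letter (n := n) P Q
  set ν := (Measure.pi fun _ : Fin n => P).prod Q
  set r : ℕ → (Fin n → α) × (Fin n → β) → ℝ := fun k =>
    ν[fun x => (μ.rnDeriv ν x).toReal | prefixAlgebra α (Fin n → β) n k] with hr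
  have hQp := isProbabilityMeasure_map_eval Q
  have : IsProbabilityMeasure Q₁ := hQ₁ ▸ inferInstance
  have : IsProbabilityMeasure μ₁ := hμ₁ ▸ inferInstance
  have hle : ∀ k, prefixAlgebra α (Fin n → β) n k ≤ Prod.instMeasurableSpace := prefixAlgebra_le n
  have hrm' : ∀ k, Measurable[prefixAlgebra α (Fin n → β) n k] (r k) := fun k =>
    stronglyMeasurable_condExp.measurable
  have hrm : ∀ k, Measurable (r k) := fun k => (hrm' k).mono (hle k) le_rfl
  have hri : ∀ k, Integrable (r k) ν := fun k => integrable_condExp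
  have hr0 : ∀ k, 0 ≤ᵐ[ν] r k := fun k => condExp_nonneg (ae_of_all _ fun _ => ENNReal.toReal_nonneg)
  have hfr : ∀ k, Integrable (fun z => f (r k z)) ν := fun k =>
    hf.convexOn.integrable_comp_condExp_rnDeriv (hle k) hμ hfm.stronglyMeasurable
      hf.continuousWithinAt_zero hint
  -- The martingale property gives E B(r_{k+1}, r_k) = E f(r_{k+1}) - E f(r_k).
  have htower : ∀ k, r k =ᵐ[ν] ν[r (k + 1) | prefixAlgebra α (Fin n → β) n k] := fun k =>
    (condExp_condExp_of_le (prefixAlgebra_mono (Nat.le_succ k)) (hle _)).symm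
  have hstep := fun k => hf.integral_bregman_condExp (hle k) (hri (k + 1)) (hr0 (k + 1)) (htower k)
    (hrm' k) (hfr (k + 1)) (hfr k)
  have hzero : ∀ k, ∀ᵐ z ∂ν, r k z = 0 → r (k + 1) z = 0 := fun k =>
    ae_eq_zero_of_condExp_eq_zero (hle k) (hri (k + 1)) (hr0 (k + 1)) (htower k) (hrm' k)
  have hbm : ∀ k : Fin n, Measurable fun z => bregman f (r (k + 1) z) (r k z) := by
    intro k
    have := measurable_deriv f
    have := hrm k
    have := hrm (k + 1)
    unfold bregman
    fun_prop
  have hae : ∀ p : Fin n → (Fin n → α) × (Fin n → β) → Prop,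
      (∀ k, MeasurableSet {z | p k z}) → (∀ k, ∀ᵐ z ∂ν, p k z) →
      ∀ᵐ z ∂((uniformFin n).prod ν), p z.1 z.2 := by
    intro p hpm hp
    have hms : MeasurableSet {z : Fin n × ((Fin n → α) × (Fin n → β)) | p z.1 z.2} :=
      measurable_uncurry_fin (w := p) (fun k => measurableSet_setOfPred.1 (hpm k)) |>.setOf
    exact (Measure.ae_prod_mem_iff_ae_ae_mem hms).2 (ae_of_all _ hp)
  have hn0 : (n : ℝ) ≠ 0 := Nat.cast_ne_zero.2 (NeZero.ne n)
  have hmain := hf.integral_sub_le_integral_bregman hfm (ν := (uniformFin n).prod ν)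
    (u := fun p => r (p.1 + 1) p.2) (v := fun p => r p.1 p.2)
    (measurable_uncurry_fin (w := fun k : Fin n => r (k + 1)) fun k => hrm _)
    (measurable_uncurry_fin (w := fun k : Fin n => r k) fun k => hrm _)
    (integrable_uniformFin_prod (w := fun k : Fin n => r (k + 1)) (fun k => hrm _) fun k => hri _)
    (hae (fun k z => 0 ≤ r (k + 1) z) (fun k => measurableSet_le measurable_const (hrm _))
      fun k => hr0 _)
    (integrable_uniformFin_prod (w := fun k : Fin n => r k) (fun k => hrm _) fun k => hri _)
    (hae (fun k z => 0 ≤ r k z) (fun k => measurableSet_le measurable_const (hrm _))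
      fun k => hr0 _)
    (hae (fun k z => r k z = 0 → r (k + 1) z = 0)
      (fun k => (hrm k (measurableSet_singleton 0)).imp (hrm (k + 1) (measurableSet_singleton 0)))
      fun k => hzero k)
    (integrable_uniformFin_prod (w := fun (k : Fin n) z => f (r (k + 1) z))
      (fun k => hfm.comp (hrm _)) fun k => hfr _)
    (integrable_uniformFin_prod (w := fun (k : Fin n) z => bregman f (r (k + 1) z) (r k z))
      hbm fun k => (hstep k).1)
    (π := fun p => (p.2.1 p.1, p.2.2 p.1)) (P := P) (Q := Q₁) (μ := μ₁)
    (measurable_uncurry_fin (w := fun (k : Fin n) (z : (Fin n → α) × (Fin n → β)) =>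
      (z.1 k, z.2 k)) measurable_letter) ?_ ?_ ?_
  · refine ⟨hmain.1, hmain.2.1, ?_⟩
    have h := hmain.2.2
    -- The sum telescopes: r_n is dμ/dν itself, and r_0, which conditions on the reproduction alone,
    -- is the density of its marginal.
    rw [integral_uniformFin_prod (w := fun (k : Fin n) z => bregman f (r (k + 1) z) (r k z))
      hbm fun k => (hstep k).1, Finset.sum_congr rfl fun (k : Fin n) _ => (hstep k).2,
      Fin.sum_univ_eq_sum_range
        (fun k => ∫ z, f (r (k + 1) z) ∂ν - ∫ z, f (r k z) ∂ν) n,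
      Finset.sum_range_sub (fun k => ∫ z, f (r k z) ∂ν)] at h
    have hrn : r n = fun x => (μ.rnDeriv ν x).toReal := by
      simp only [hr, prefixAlgebra_self]
      exact condExp_of_stronglyMeasurable le_rfl
        (Measure.measurable_rnDeriv _ _).ennreal_toReal.stronglyMeasurable
        Measure.integrable_toReal_rnDeriv
    have hsnd : ν.map Prod.snd = Q := Measure.snd_prod
    have hr0' : r 0 =ᵐ[ν] fun z => (μ.snd.rnDeriv Q z.2).toReal := by
      have : SigmaFinite (ν.map Prod.snd) := by rw [hsnd]; infer_instance
      have h := toReal_rnDeriv_map hμ measurable_snd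
      rw [hsnd] at h
      simp only [hr, prefixAlgebra_zero]
      exact h.symm
    have hQ : ∫ z, f (r 0 z) ∂ν = ∫ y, f (μ.snd.rnDeriv Q y).toReal ∂Q := by
      have h := integral_map (μ := ν) measurable_snd.aemeasurable
        (f := fun y => f (μ.snd.rnDeriv Q y).toReal)
        (hfm.comp (Measure.measurable_rnDeriv _ _).ennreal_toReal).aestronglyMeasurable
      rw [hsnd] at h
      rw [h]
      exact integral_congr_ae (by filter_upwards [hr0'] with z hz; rw [hz])
    rw [hQ, hrn] at h
    calc _ ≤ (n : ℝ) * ((n : ℝ)⁻¹ * _) := mul_le_mul_of_nonneg_left h (Nat.cast_nonneg n)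
      _ = _ := by rw [mul_inv_cancel_left₀ hn0]
  · have h := map_withDensity_uniformFin_prod ν (w := fun _ _ => 1)
      (fun k => measurable_const) (π := fun (k : Fin n) z => (z.1 k, z.2 k)) measurable_letter
    have e₁ : (ν.withDensity fun _ => (1 : ℝ≥0∞)) = ν := withDensity_one
    have e₂ : (((uniformFin n).prod ν).withDensity fun _ => (1 : ℝ≥0∞)) = (uniformFin n).prod ν :=
      withDensity_one
    rw [e₂] at h
    simp only [e₁, hprod] at h
    rw [hQ₁, prod_avg]
    exact h
  · rw [hμ₁]
    refine (map_withDensity_uniformFin_prod ν (w := fun (k : Fin n) x => ENNReal.ofReal (r (k + 1) x))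
      (fun k => (hrm _).ennreal_ofReal) (π := fun (k : Fin n) z => (z.1 k, z.2 k))
      measurable_letter).trans ?_
    exact congrArg avg (funext hsucc)
  · have h2 : μ₁.snd = avg fun k => (letterLaw μ k).snd := by
      rw [hμ₁]; exact map_avg _ measurable_snd
    rw [h2, prod_avg]
    refine (map_withDensity_uniformFin_prod ν (w := fun (k : Fin n) x => ENNReal.ofReal (r k x))
      (fun k => (hrm _).ennreal_ofReal) (π := fun (k : Fin n) z => (z.1 k, z.2 k))
      measurable_letter).trans ?_
    exact congrArg avg (funext hself)

end Letters

/-! ### Single-letter channels induced by a block channel -/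

section Channel

variable {α β : Type*} [MeasurableSpace α] [MeasurableSpace β] {n : ℕ}

/-- The channel from `X_k` to `X̂_k` induced by a block channel and an i.i.d. source. -/
noncomputable def letterKernel (P : Measure α) (κ : Kernel (Fin n → α) (Fin n → β)) (k : Fin n) :
    Kernel α β :=
  ((κ.comap (fun p : α × (Fin n → α) => Function.update p.2 k p.1)
    (measurable_update_pair k)).map (fun y => y k)).comp
    (Kernel.id.prod (Kernel.const α (Measure.pi fun _ : Fin n => P)))

variable (P : Measure α) [IsProbabilityMeasure P] (κ : Kernel (Fin n → α) (Fin n → β))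

instance [IsMarkovKernel κ] (k : Fin n) : IsMarkovKernel (letterKernel P κ k) := by
  unfold letterKernel
  have : IsMarkovKernel ((κ.comap (fun p : α × (Fin n → α) => Function.update p.2 k p.1)
    (measurable_update_pair k)).map (fun y => y k)) :=
    Kernel.IsMarkovKernel.map _ (measurable_pi_apply k)
  infer_instance

lemma letterKernel_apply (k : Fin n) (x : α) {s : Set β} (hs : MeasurableSet s) :
    letterKernel P κ k x s = ∫⁻ z, κ (Function.update z k x) ((fun y => y k) ⁻¹' s)
      ∂(Measure.pi fun _ : Fin n => P) := by
  have hm : Measurable fun p : α × (Fin n → α) =>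
      κ (Function.update p.2 k p.1) ((fun y => y k) ⁻¹' s) :=
    (κ.measurable_coe (measurable_pi_apply k hs)).comp (measurable_update_pair k)
  rw [letterKernel, Kernel.comp_apply' _ _ _ hs, Kernel.prod_apply, Kernel.id_apply,
    Kernel.const_apply]
  have hmap : ∀ p : α × (Fin n → α),
      ((κ.comap (fun p : α × (Fin n → α) => Function.update p.2 k p.1)
        (measurable_update_pair k)).map (fun y => y k)) p s =
      κ (Function.update p.2 k p.1) ((fun y => y k) ⁻¹' s) := fun p => by
    rw [Kernel.map_apply' _ (measurable_pi_apply k) _ hs, Kernel.comap_apply]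
  simp only [hmap]
  rw [lintegral_prod _ hm.aemeasurable, lintegral_dirac' _ hm.lintegral_prod_right']

variable [IsMarkovKernel κ]

/-- The letter channel draws a fresh i.i.d. block and overwrites coordinate k by the input; by
resampling invariance, an input of law P yields the i.i.d. block law. -/
lemma compProd_letterKernel (k : Fin n) :
    P.compProd (letterKernel P κ k) = letterLaw (blockLaw P κ) k := by
  ext S hS
  have hS' := measurable_letter (α := α) (β := β) k hS
  have hm : Measurable fun w : Fin n → α =>
      κ w (Prod.mk w ⁻¹' ((fun z : (Fin n → α) × (Fin n → β) => (z.1 k, z.2 k)) ⁻¹' S)) :=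
    Kernel.measurable_kernel_prodMk_left hS'
  rw [Measure.compProd_apply hS, letterLaw, Measure.map_apply (measurable_letter k) hS, blockLaw,
    Measure.compProd_apply hS', ← (measurePreserving_update P k).lintegral_comp hm]
  refine Eq.trans ?_ (lintegral_prod _ (hm.comp (measurable_update_pair k)).aemeasurable).symm
  refine lintegral_congr fun x => ?_
  rw [letterKernel_apply P κ k x (measurable_prodMk_left hS)]
  refine lintegral_congr fun z => ?_
  congr 1
  ext y
  simp

/-- The average of the letter laws comes from a single-letter channel. -/
lemma exists_kernel_compProd_eq_avg [NeZero n] : ∃ η : Kernel α β, IsMarkovKernel η ∧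
    P.compProd η = avg (letterLaw (blockLaw P κ)) := by
  let η : Kernel α β :=
    { toFun := fun x => avg fun k => letterKernel P κ k x
      measurable' := by
        refine Measure.measurable_of_measurable_coe _ fun s hs => ?_
        simp only [avg_apply]
        exact (Finset.measurable_sum _ fun k _ => Kernel.measurable_coe _ hs).const_mul _ }
  have hη : ∀ x, η x = avg fun k => letterKernel P κ k x := fun _ => rfl
  have hmk : IsMarkovKernel η := ⟨fun x => by rw [hη]; infer_instance⟩
  refine ⟨η, hmk, ?_⟩
  ext S hS
  rw [Measure.compProd_apply hS, avg_apply]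
  simp only [hη, avg_apply]
  have hm : ∀ k, Measurable fun x => letterKernel P κ k x (Prod.mk x ⁻¹' S) := fun k =>
    Kernel.measurable_kernel_prodMk_left hS
  rw [lintegral_const_mul _ (Finset.measurable_sum _ fun k _ => hm k),
    lintegral_finsetSum _ fun k _ => hm k]
  simp only [← compProd_letterKernel P κ, Measure.compProd_apply hS]

instance [NeZero n] : IsProbabilityMeasure (blockLaw P κ) := by
  unfold blockLaw; infer_instance

lemma fst_blockLaw : (blockLaw P κ).fst = Measure.pi fun _ : Fin n => P := Measure.fst_compProd _ _

end Channel

/-! ### Linearity of the expected distortion -/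

section Distortion

variable {α β : Type*} [MeasurableSpace α] [MeasurableSpace β] {n : ℕ}

/-- No finiteness is needed: `EReal` addition is commutative and associative even through ∞ - ∞, and
negation distributes over sums of terms that are never `⊥`. -/
lemma coe_ennreal_sum_sub {ι : Type*} (s : Finset ι) (p q : ι → ℝ≥0∞) :
    ((∑ k ∈ s, p k : ℝ≥0∞) : EReal) - (∑ k ∈ s, q k : ℝ≥0∞) =
      ∑ k ∈ s, ((p k : EReal) - (q k : EReal)) := by
  have hp : ((∑ k ∈ s, p k : ℝ≥0∞) : EReal) = ∑ k ∈ s, (p k : EReal) := by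
    classical
    induction s using Finset.induction_on with
    | empty => simp
    | insert a s ha ih => rw [Finset.sum_insert ha, Finset.sum_insert ha, EReal.coe_ennreal_add, ih]
  have hq : -((∑ k ∈ s, q k : ℝ≥0∞) : EReal) = ∑ k ∈ s, -(q k : EReal) := by
    classical
    clear hp
    induction s using Finset.induction_on with
    | empty => simp
    | insert a s ha ih =>
      rw [Finset.sum_insert ha, Finset.sum_insert ha, EReal.coe_ennreal_add,
        EReal.neg_add (Or.inl (EReal.coe_ennreal_ne_bot _)) (Or.inr (EReal.coe_ennreal_ne_bot _)),
        sub_eq_add_neg, ih]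
  simp only [sub_eq_add_neg, Finset.sum_add_distrib, hp, hq]

lemma expDistortion_avg [NeZero n] (d : α → β → ℝ) (μ : Fin n → Measure (α × β)) :
    expDistortion d (avg μ) = ((1 / (n : ℝ) : ℝ) : EReal) * ∑ k, expDistortion d (μ k) := by
  have hc : (((n : ℝ≥0∞)⁻¹ : ℝ≥0∞) : EReal) = ((1 / (n : ℝ) : ℝ) : EReal) := by
    have : (n : ℝ≥0∞)⁻¹ = ENNReal.ofReal (1 / (n : ℝ)) := by
      rw [one_div, ENNReal.ofReal_inv_of_pos (Nat.cast_pos.2 (NeZero.pos n)), ENNReal.ofReal_natCast]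
    rw [this, EReal.coe_ennreal_ofReal, max_eq_left (by positivity)]
  have hc0 : (0 : EReal) ≤ ((1 / (n : ℝ) : ℝ) : EReal) := EReal.coe_nonneg.2 (by positivity)
  simp only [expDistortion, posDistortion, negDistortion, lintegral_avg, EReal.coe_ennreal_mul, hc]
  rw [← coe_ennreal_sum_sub, sub_eq_add_neg, sub_eq_add_neg,
    EReal.left_distrib_of_nonneg_of_ne_top hc0 (EReal.coe_ne_top _), mul_neg]

lemma posDistortion_avg_ne_top [NeZero n] {d : α → β → ℝ} {μ : Fin n → Measure (α × β)}
    (h : ∀ k, posDistortion d (μ k) ≠ ⊤) : posDistortion d (avg μ) ≠ ⊤ := by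
  simp only [posDistortion, lintegral_avg]
  exact ENNReal.mul_ne_top (by simp [NeZero.ne n]) (ENNReal.sum_ne_top.2 fun k _ => h k)

lemma negDistortion_avg_ne_top [NeZero n] {d : α → β → ℝ} {μ : Fin n → Measure (α × β)}
    (h : ∀ k, negDistortion d (μ k) ≠ ⊤) : negDistortion d (avg μ) ≠ ⊤ := by
  simp only [negDistortion, lintegral_avg]
  exact ENNReal.mul_ne_top (by simp [NeZero.ne n]) (ENNReal.sum_ne_top.2 fun k _ => h k)

/-- The single-letter bound for a correlation measure that does not exceed `R` at the average of the
letter laws when it does not exceed `n R` at the block law. -/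
lemma distortionRate_le_blockDistortionRate [NeZero n] {I : Measure (α × β) → EReal}
    {J : Measure ((Fin n → α) × (Fin n → β)) → EReal} (P : Measure α) [IsProbabilityMeasure P]
    (d : α → β → ℝ) (R : ℝ)
    (hIJ : ∀ μ : Measure ((Fin n → α) × (Fin n → β)), IsProbabilityMeasure μ →
      μ.fst = (Measure.pi fun _ : Fin n => P) → (avg (letterLaw μ)).fst = P →
      J μ ≤ (((n : ℝ) * R : ℝ) : EReal) → I (avg (letterLaw μ)) ≤ R) :
    distortionRate I P d R ≤ blockDistortionRate n J P d R := by
  refine le_iInf fun κ => le_iInf fun hκ => le_iInf fun hJ => le_iInf fun hd => ?_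
  obtain ⟨η, hη, hηeq⟩ := exists_kernel_compProd_eq_avg P κ
  have hI := hIJ (blockLaw P κ) inferInstance (fst_blockLaw P κ)
    (by rw [← hηeq, Measure.fst_compProd]) hJ
  rw [← expDistortion_avg, ← hηeq]
  rw [← hηeq] at hI
  refine iInf_le_of_le η (iInf_le_of_le hη (iInf_le_of_le hI (iInf_le_of_le ?_ le_rfl)))
  rw [hηeq]
  -- Excluding ∞ - ∞ between letters is what keeps the averaged expectation well defined.
  exact hd.imp posDistortion_avg_ne_top negDistortion_avg_ne_top

end Distortion

/-! ### Basic properties of the f-divergence -/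

section Divergence

variable {α : Type*} [MeasurableSpace α] {f : ℝ → ℝ} {μ ν : Measure α}

lemma fDiv_of_integrable (h : μ ≪ ν)
    (hi : Integrable (fun a => f (μ.rnDeriv ν a).toReal) ν) :
    fDiv f μ ν = ((∫ a, f (μ.rnDeriv ν a).toReal ∂ν : ℝ) : EReal) := if_pos ⟨h, hi⟩

lemma fDiv_ne_top_iff : fDiv f μ ν ≠ ⊤ ↔
    μ ≪ ν ∧ Integrable (fun a => f (μ.rnDeriv ν a).toReal) ν := by
  by_cases h : μ ≪ ν ∧ Integrable (fun a => f (μ.rnDeriv ν a).toReal) ν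
  · simp only [h, and_self, iff_true, fDiv_of_integrable h.1 h.2]
    exact EReal.coe_ne_top _
  · simp [fDiv, h]

lemma fDiv_self (hf : f 1 = 0) [SigmaFinite μ] : fDiv f μ μ = 0 := by
  have h : (fun a => f (μ.rnDeriv μ a).toReal) =ᵐ[μ] fun _ => 0 := by
    filter_upwards [μ.rnDeriv_self] with x hx
    simp [hx, hf]
  rw [fDiv_of_integrable Measure.AbsolutelyContinuous.rfl
    ((integrable_congr h).2 (integrable_zero _ _ _)), integral_congr_ae h]
  simp

lemma fDiv_congr {g : ℝ → ℝ} (h : ∀ t, 0 ≤ t → f t = g t) : fDiv f μ ν = fDiv g μ ν := by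
  have : (fun a => f (μ.rnDeriv ν a).toReal) = fun a => g (μ.rnDeriv ν a).toReal :=
    funext fun a => h _ ENNReal.toReal_nonneg
  rw [fDiv, fDiv, this]

/-- The values of f on negative reals are arbitrary and may spoil measurability. This modification
is continuous and leaves all divergences unchanged. -/
lemma ClassF.max_zero (hf : ClassF f) : ClassF fun t => f (max t 0) := by
  have heq : ∀ t : ℝ, 0 < t → (fun t => f (max t 0)) =ᶠ[𝓝 t] f := fun t ht => by
    filter_upwards [lt_mem_nhds ht] with s hs
    rw [max_eq_left hs.le]
  have hd : ∀ t : ℝ, 0 < t → deriv (fun t => f (max t 0)) =ᶠ[𝓝 t] deriv f := fun t ht =>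
    (heq t ht).deriv
  have he : EqOn f (fun t => f (max t 0)) (Ici 0) := fun t ht => by
    simp only [max_eq_left (mem_Ici.1 ht)]
  exact
    { convexOn := hf.convexOn.congr he
      map_one := by simpa using hf.map_one
      continuousWithinAt_zero := hf.continuousWithinAt_zero.congr (fun t ht => (he ht).symm)
        (he (mem_Ici.2 le_rfl)).symm
      differentiableAt := fun t ht => (heq t ht).differentiableAt_iff.2 (hf.differentiableAt t ht)
      differentiableAt_deriv := fun t ht =>
        (hd t ht).differentiableAt_iff.2 (hf.differentiableAt_deriv t ht)
      deriv_deriv_pos := fun t ht => by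
        rw [(hd t ht).deriv_eq]; exact hf.deriv_deriv_pos t ht
      concaveOn_inv := hf.concaveOn_inv.congr fun t ht => by rw [(hd t ht).deriv_eq] }

lemma ClassF.measurable_max_zero (hf : ClassF f) : Measurable fun t => f (max t 0) :=
  (hf.continuousOn.comp_continuous (by fun_prop) fun _ => mem_Ici.2 (le_max_right _ _)).measurable

lemma infoCKZ_congr {β : Type*} [MeasurableSpace β] {g : ℝ → ℝ} {μ : Measure (α × β)}
    (h : ∀ t, 0 ≤ t → f t = g t) : infoCKZ f μ = infoCKZ g μ := fDiv_congr h

lemma infoMBGYA_congr {β : Type*} [MeasurableSpace β] {g : ℝ → ℝ} {μ : Measure (α × β)}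
    (h : ∀ t, 0 ≤ t → f t = g t) : infoMBGYA f μ = infoMBGYA g μ := by
  simp only [infoMBGYA, fDiv_congr h]

end Divergence

/-! ### The two information measures -/

section Information

variable {α β : Type*} [MeasurableSpace α] [MeasurableSpace β] {n : ℕ} [NeZero n] {f : ℝ → ℝ}
  {P : Measure α} [IsProbabilityMeasure P] {μ : Measure ((Fin n → α) × (Fin n → β))}
  [IsProbabilityMeasure μ] {R : ℝ}

/-- The single-letter bound for the difference `D_f(P_{AB} ‖ P_A × Q_B) - D_f(P_B ‖ Q_B)`. -/
lemma ClassF.fDiv_sub_fDiv_avg_le (hf : ClassF f) (hfm : Measurable f)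
    (hμ : μ.fst = Measure.pi fun _ : Fin n => P) (hμ₁ : (avg (letterLaw μ)).fst = P)
    {Q : Measure (Fin n → β)} [IsProbabilityMeasure Q] (hQ : fDiv f μ.snd Q ≠ ⊤)
    (h : fDiv f μ (μ.fst.prod Q) - fDiv f μ.snd Q ≤ (((n : ℝ) * R : ℝ) : EReal))
    {Q₁ : Measure β} (hQ₁ : Q₁ = avg fun k => Q.map fun y => y k) :
    (avg (letterLaw μ)).snd ≪ Q₁ ∧ fDiv f (avg (letterLaw μ)).snd Q₁ ≠ ⊤ ∧
      fDiv f (avg (letterLaw μ)) ((avg (letterLaw μ)).fst.prod Q₁) -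
        fDiv f (avg (letterLaw μ)).snd Q₁ ≤ R := by
  rw [hμ] at h
  rw [hμ₁]
  have hQ' := fDiv_ne_top_iff.1 hQ
  rw [fDiv_of_integrable hQ'.1 hQ'.2] at h
  -- The subtracted divergence is finite, so a finite bound on the difference forces the first
  -- divergence to be finite.
  have hD : fDiv f μ ((Measure.pi fun _ : Fin n => P).prod Q) ≠ ⊤ := by
    intro htop
    rw [htop, EReal.top_sub_coe, top_le_iff] at h
    exact EReal.coe_ne_top _ h
  have hD' := fDiv_ne_top_iff.1 hD
  rw [fDiv_of_integrable hD'.1 hD'.2, ← EReal.coe_sub, EReal.coe_le_coe_iff] at h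
  obtain ⟨h1, h2, h3⟩ := hf.letter_le_block hfm hD'.1 hD'.2 rfl hQ₁
  refine ⟨h2.1, fDiv_ne_top_iff.2 h2, ?_⟩
  rw [fDiv_of_integrable h1.1 h1.2, fDiv_of_integrable h2.1 h2.2, ← EReal.coe_sub,
    EReal.coe_le_coe_iff]
  exact le_of_mul_le_mul_left (h3.trans h) (Nat.cast_pos.2 (NeZero.pos n))

/-- The case Q = P_B: the subtracted divergence vanishes, and the averaged coordinate marginals of Q
form the marginal of the averaged letter law. -/
lemma ClassF.infoCKZ_avg_le (hf : ClassF f) (hfm : Measurable f)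
    (hμ : μ.fst = Measure.pi fun _ : Fin n => P) (hμ₁ : (avg (letterLaw μ)).fst = P)
    (h : infoCKZ f μ ≤ (((n : ℝ) * R : ℝ) : EReal)) : infoCKZ f (avg (letterLaw μ)) ≤ R := by
  have hself := fDiv_self (μ := μ.snd) hf.map_one
  have hsnd : (avg (letterLaw μ)).snd = avg fun k => μ.snd.map fun y => y k := by
    rw [Measure.snd, map_avg _ measurable_snd]
    exact congrArg avg (funext (snd_letterLaw μ))
  have := (hf.fDiv_sub_fDiv_avg_le hfm hμ hμ₁ (Q := μ.snd) (by rw [hself]; exact EReal.zero_ne_top)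
    (by rw [hself, sub_zero]; exact h) hsnd).2.2
  rwa [fDiv_self hf.map_one, sub_zero] at this

lemma ClassF.infoMBGYA_avg_le (hf : ClassF f) (hfm : Measurable f)
    (hμ : μ.fst = Measure.pi fun _ : Fin n => P) (hμ₁ : (avg (letterLaw μ)).fst = P)
    (h : infoMBGYA f μ ≤ (((n : ℝ) * R : ℝ) : EReal)) : infoMBGYA f (avg (letterLaw μ)) ≤ R := by
  by_contra hlt
  -- The infimum need not be attained; the slack c > R supplies a Q with value below n c.
  obtain ⟨c, hRc, hc⟩ := EReal.lt_iff_exists_real_btwn.1 (not_le.1 hlt)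
  have hn : (0 : ℝ) < n := Nat.cast_pos.2 (NeZero.pos n)
  have h' : infoMBGYA f μ < (((n : ℝ) * c : ℝ) : EReal) := h.trans_lt
    (EReal.coe_lt_coe_iff.2 (mul_lt_mul_of_pos_left (EReal.coe_lt_coe_iff.1 hRc) hn))
  simp only [infoMBGYA, iInf_lt_iff] at h'
  obtain ⟨Q, hQp, -, hQ, hJ⟩ := h'
  have hp := isProbabilityMeasure_map_eval Q
  obtain ⟨h1, h2, h3⟩ := hf.fDiv_sub_fDiv_avg_le hfm hμ hμ₁ hQ hJ.le rfl
  refine hc.not_ge (le_trans ?_ h3)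
  exact iInf_le_of_le _ (iInf_le_of_le inferInstance (iInf_le_of_le h1 (iInf_le_of_le h2 le_rfl)))

end Information

end FInfo

theorem mainTheorem7 {𝒳 𝒴 : Type*} [MeasurableSpace 𝒳] [MeasurableSpace 𝒴]
    (f : ℝ → ℝ) (hf : FInfo.ClassF f)
    (P : Measure 𝒳) [IsProbabilityMeasure P]
    (d : 𝒳 → 𝒴 → ℝ) (hd : Measurable (Function.uncurry d))
    (n : ℕ) (hn : 1 ≤ n) (R : ℝ) :
    FInfo.distortionRate (FInfo.infoCKZ f) P d R ≤
        FInfo.blockDistortionRate n (FInfo.infoCKZ f) P d R ∧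
      FInfo.distortionRate (FInfo.infoMBGYA f) P d R ≤
        FInfo.blockDistortionRate n (FInfo.infoMBGYA f) P d R := by
  have : NeZero n := ⟨by omega⟩
  have hfm := hf.measurable_max_zero
  have hf₀ := hf.max_zero
  have heq : ∀ t : ℝ, 0 ≤ t → f t = (fun t => f (max t 0)) t := fun t ht => by
    simp only [max_eq_left ht]
  refine ⟨FInfo.distortionRate_le_blockDistortionRate P d R fun μ _ hμ hμ₁ h => ?_,
    FInfo.distortionRate_le_blockDistortionRate P d R fun μ _ hμ hμ₁ h => ?_⟩
  · rw [FInfo.infoCKZ_congr heq] at h ⊢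
    exact hf₀.infoCKZ_avg_le hfm hμ hμ₁ h
  · rw [FInfo.infoMBGYA_congr heq] at h ⊢
    exact hf₀.infoMBGYA_avg_le hfm hμ hμ₁ h
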